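/- Consider $N=m_1+m_2$ bosonic modes with Hilbert space $L^2(\mathbb R^{N})$, quadratures $R=(q_1,\dots,q_N,p_1,\dots,p_N)$ with $[q_k,p_l]=i\delta_{kl}$, and Hamiltonian $H=\tfrac12\sum_{i=1}^{N}(q_i^2+p_i^2)$, split into a part $\mathcal A_1$ of $m_1$ modes and a part $\mathcal A_2$ of $m_2$ modes. A displacement-free pure Gaussian state is a state $\rho=|\psi\rangle\langle\psi|$ whose characteristic function is $\langle\psi, e^{i c\cdot R}\psi\rangle=e^{-\frac14 c^{T}\Sigma c}$ for all $c\in\mathbb R^{2N}$, for some real symmetric matrix $\Sigma$. A Gaussian unitary is a unitary $U$ with $U^\dagger R\,U=SR+d$ for a real symplectic matrix $S$ and a real vector $d$. The $2$-local ergotropic gap of $\rho$ is $$\delta^{\mathcal A_1|\mathcal A_2}_{2\text{-loc}}(\rho)=\mathcal E_G(\rho)-\mathcal E^{\mathcal A_1|\mathcal A_2}_{2\text{-loc}}(\rho),$$ where $$\mathcal E_G(\rho)=\operatorname{Tr}(\rho H)-\inf_{U}\operatorname{Tr}(U\rho U^\dagger H),\qquad \mathcal E^{\mathcal A_1|\mathcal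 A_2}_{2\text{-loc}}(\rho)=\operatorname{Tr}(\rho H)-\inf_{U_1\otimes U_2}\operatorname{Tr}\big((U_1\otimes U_2)\rho (U_1\otimes U_2)^\dagger H\big),$$ with $U$ running over the Gaussian unitaries on all $N$ modes and $U_j$ over the Gaussian unitaries on the modes of $\mathcal A_j$. The mutual information is $\mathrm{MI}(\rho)=S(\rho_{\mathcal A_1})+S(\rho_{\mathcal A_2})-S(\rho)$, where $\rho_{\mathcal A_j}$ is the reduced state on $\mathcal A_j$ and $S(\sigma)=-\operatorname{Tr}(\sigma\ln\sigma)$ is the von Neumann entropy. **Proposition.** Let $2\le m_1\le m_2$. Then the $2$-local ergotropic gap is not a function of the mutual information: there is no function $F:\mathbb R\to\mathbb R$ such that $$\delta^{\mathcal A_1|\mathcal A_2}_{2\text{-loc}}(\rho)=F\big(\mathrm{MI}(\rho)\big)$$ for all displacement-free pure Gaussian states $\rho$ of the $m_1+m_2$ modes. -/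

import Mathlib

open MeasureTheory
open scoped ENNReal Matrix

noncomputable section

namespace GaussianModes

/-- The Hilbert space `L²(ℝ^ι; ℂ)` of a system of bosonic modes labelled by `ι`
(Schrödinger representation). -/
abbrev ModeSpace (ι : Type) [Fintype ι] : Type :=
  Lp ℂ 2 (volume : Measure (ι → ℝ))

section OneSystem

variable {ι : Type} [Fintype ι]

/-- The function `x ↦ exp (i (u · x + u · v / 2)) ψ (x + v)`, where `c = (u, v)`. -/
def weylFun (c : ι ⊕ ι → ℝ) (ψ : (ι → ℝ) → ℂ) (x : ι → ℝ) : ℂ :=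
  Complex.exp
      (Complex.I * ((∑ i, c (Sum.inl i) * x i + (∑ i, c (Sum.inl i) * c (Sum.inr i)) / 2 : ℝ) : ℂ))
    * ψ (x + c ∘ Sum.inr)

theorem memLp_weylFun (c : ι ⊕ ι → ℝ) (ψ : ModeSpace ι) :
    MemLp (weylFun c ψ) 2 (volume : Measure (ι → ℝ)) := by
  have h1 : MemLp (fun x : ι → ℝ => (ψ : (ι → ℝ) → ℂ) (x + c ∘ Sum.inr)) 2
      (volume : Measure (ι → ℝ)) :=
    (Lp.memLp ψ).comp_measurePreserving (measurePreserving_add_right volume (c ∘ Sum.inr))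
  refine (memLp_congr_norm ?_ h1.1 ?_).2 h1
  · refine AEStronglyMeasurable.mul ?_ h1.1
    exact Continuous.aestronglyMeasurable (by fun_prop)
  · refine Filter.Eventually.of_forall fun x => ?_
    rw [weylFun, norm_mul, mul_comm Complex.I, Complex.norm_exp_ofReal_mul_I, one_mul]

/-- The Weyl operator `W(c) = exp (i ∑ⱼ cⱼ Rⱼ)`, where `R = (q, p)` is the vector of quadratures:
`Sum.inl i` labels the position `qᵢ` and `Sum.inr i` the momentum `pᵢ = -i ∂ᵢ`,
with `[q_k, p_l] = i δ_{kl}`. -/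
def weyl (c : ι ⊕ ι → ℝ) (ψ : ModeSpace ι) : ModeSpace ι :=
  (memLp_weylFun c ψ).toLp (weylFun c ψ)

/-- `ψ` is the state vector of a displacement-free Gaussian state: its characteristic function is
`⟨ψ, W(c) ψ⟩ = exp (-cᵀ V c / 4)` for a real symmetric matrix `V`, the covariance matrix
`V_{jk} = ⟨R_j R_k + R_k R_j⟩` (the vacuum has `V = 1`). At `c = 0` this says `‖ψ‖ = 1`. -/
def IsPureGaussian (ψ : ModeSpace ι) : Prop :=
  ∃ V : Matrix (ι ⊕ ι) (ι ⊕ ι) ℝ, V.IsSymm ∧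
    ∀ c : ι ⊕ ι → ℝ, inner ℂ ψ (weyl c ψ) = Complex.exp ((-(c ⬝ᵥ V *ᵥ c) / 4 : ℝ) : ℂ)

variable [DecidableEq ι]

/-- `U` is a Gaussian unitary: in the Heisenberg picture it acts on the quadratures as
`U† R U = S R + d`, with `S` symplectic and `d` real, i.e. `U† W(c) U = exp (i c·d) W(Sᵀ c)`. -/
def IsGaussianUnitary (U : ModeSpace ι ≃ₗᵢ[ℂ] ModeSpace ι) : Prop :=
  ∃ S ∈ Matrix.symplecticGroup ι ℝ, ∃ d : ι ⊕ ι → ℝ, ∀ (c : ι ⊕ ι → ℝ) (φ : ModeSpace ι),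
    weyl c (U φ) = Complex.exp (Complex.I * ((c ⬝ᵥ d : ℝ) : ℂ)) • U (weyl (Sᵀ *ᵥ c) φ)

/-- `⟨ψ, R_j² ψ⟩ = ‖R_j ψ‖² ∈ [0, ∞]`. As `R_j` is the self-adjoint generator of
`t ↦ W(t e_j) = exp (i t R_j)`, this is the limit for `t → 0`, and also the supremum, of
`‖W(t e_j) ψ - ψ‖² / t²`, which is `∞` exactly when `ψ` is not in the domain of `R_j`.
(At `t = 0` the quotient is `0 / 0 = 0` and does not affect the supremum.) -/
def quadratureSq (j : ι ⊕ ι) (ψ : ModeSpace ι) : ℝ≥0∞ :=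
  ⨆ t : ℝ, ENNReal.ofReal (‖weyl (Pi.single j t) ψ - ψ‖ ^ 2 / t ^ 2)

/-- The energy `⟨ψ, H ψ⟩ ∈ [0, ∞]` for `H = ½ ∑ᵢ (qᵢ² + pᵢ²)`. -/
def energy (ψ : ModeSpace ι) : ℝ≥0∞ :=
  (∑ j, quadratureSq j ψ) / 2

/-- Global Gaussian ergotropy: the energy of the state minus the least energy that is reached by
Gaussian unitaries on all modes. -/
def globalErgotropy (ψ : ModeSpace ι) : ℝ :=
  (energy ψ).toReal -
    (⨅ U : {U : ModeSpace ι ≃ₗᵢ[ℂ] ModeSpace ι // IsGaussianUnitary U}, energy (U.1 ψ)).toReal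

end OneSystem

section Entropy

variable {E : Type} [NormedAddCommGroup E] [InnerProductSpace ℂ E]

/-- The von Neumann entropy `-Tr (ρ ln ρ) = -∑ p ln p ∈ [0, ∞]` of a density operator, where the
sum runs over the eigenvalues `p` of `ρ`, repeated according to their multiplicity. -/
def vonNeumannEntropy (ρ : E →L[ℂ] E) : ℝ≥0∞ :=
  ∑' p : ℝ, (Module.finrank ℂ (Module.End.eigenspace (ρ : E →ₗ[ℂ] E) (p : ℂ)) : ℝ≥0∞) *
    ENNReal.ofReal (Real.negMulLog p)

/-- The density operator `|ψ⟩⟨ψ|`. -/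
def pureState (ψ : E) : E →L[ℂ] E :=
  InnerProductSpace.rankOne ℂ ψ ψ

variable (E) [CompleteSpace E]

/-- The index set of some orthonormal (Hilbert) basis of `E`. -/
def onbIndex : Set E := (exists_hilbertBasis ℂ E).choose

/-- Some orthonormal (Hilbert) basis of `E`. -/
def onb : HilbertBasis (onbIndex E) ℂ E := (exists_hilbertBasis ℂ E).choose_spec.choose

end Entropy

section TwoSystems

variable {ι κ : Type} [Fintype ι] [Fintype κ]

/-- The function `(x, y) ↦ f x * g y`. -/
def tensorFun (f : (ι → ℝ) → ℂ) (g : (κ → ℝ) → ℂ) (z : ι ⊕ κ → ℝ) : ℂ :=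
  f (z ∘ Sum.inl) * g (z ∘ Sum.inr)

theorem quasi_inl : Measure.QuasiMeasurePreserving
    (fun z : ι ⊕ κ → ℝ => z ∘ Sum.inl) volume volume :=
  Measure.quasiMeasurePreserving_fst.comp
    (volume_measurePreserving_sumPiEquivProdPi (fun _ : ι ⊕ κ => ℝ)).quasiMeasurePreserving

theorem quasi_inr : Measure.QuasiMeasurePreserving
    (fun z : ι ⊕ κ → ℝ => z ∘ Sum.inr) volume volume :=
  Measure.quasiMeasurePreserving_snd.comp
    (volume_measurePreserving_sumPiEquivProdPi (fun _ : ι ⊕ κ => ℝ)).quasiMeasurePreserving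

theorem aestronglyMeasurable_tensorFun (f : ModeSpace ι) (g : ModeSpace κ) :
    AEStronglyMeasurable (tensorFun f g) (volume : Measure (ι ⊕ κ → ℝ)) :=
  ((Lp.aestronglyMeasurable f).comp_quasiMeasurePreserving quasi_inl).mul
    ((Lp.aestronglyMeasurable g).comp_quasiMeasurePreserving quasi_inr)

theorem eLpNorm_tensorFun (f : ModeSpace ι) (g : ModeSpace κ) :
    eLpNorm (tensorFun f g) 2 (volume : Measure (ι ⊕ κ → ℝ)) =
      eLpNorm f 2 volume * eLpNorm g 2 volume := by
  have h2 : (2 : ℝ≥0∞) ≠ 0 := by norm_num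
  have h2' : (2 : ℝ≥0∞) ≠ ∞ := by norm_num
  rw [eLpNorm_eq_lintegral_rpow_enorm_toReal h2 h2', eLpNorm_eq_lintegral_rpow_enorm_toReal h2 h2',
    eLpNorm_eq_lintegral_rpow_enorm_toReal h2 h2', ← ENNReal.mul_rpow_of_nonneg _ _ (by positivity)]
  congr 1
  rw [← lintegral_prod_mul ((Lp.aestronglyMeasurable f).enorm.pow_const _)
    ((Lp.aestronglyMeasurable g).enorm.pow_const _)]
  rw [← Measure.volume_eq_prod, ← (volume_measurePreserving_sumPiEquivProdPi
    (fun _ : ι ⊕ κ => ℝ)).lintegral_comp_emb (MeasurableEquiv.measurableEmbedding _)]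
  refine lintegral_congr fun z => ?_
  rw [tensorFun, enorm_mul, ENNReal.mul_rpow_of_nonneg _ _ (by positivity)]
  rfl

theorem memLp_tensorFun (f : ModeSpace ι) (g : ModeSpace κ) :
    MemLp (tensorFun f g) 2 (volume : Measure (ι ⊕ κ → ℝ)) :=
  ⟨aestronglyMeasurable_tensorFun f g, by
    rw [eLpNorm_tensorFun]
    exact ENNReal.mul_lt_top (Lp.memLp f).2 (Lp.memLp g).2⟩

/-- The product vector `f ⊗ g`, as a bounded bilinear map
`L²(ℝ^ι) × L²(ℝ^κ) → L²(ℝ^ι × ℝ^κ) = L²(ℝ^(ι ⊕ κ))`. -/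
def tensor : ModeSpace ι →L[ℂ] ModeSpace κ →L[ℂ] ModeSpace (ι ⊕ κ) :=
  LinearMap.mkContinuous₂
    (LinearMap.mk₂ ℂ (fun f g => (memLp_tensorFun f g).toLp (tensorFun f g))
      (fun f f' g => by
        rw [← MemLp.toLp_add]
        refine MemLp.toLp_congr _ _ ?_
        filter_upwards [quasi_inl.ae (Lp.coeFn_add f f')] with z hz
        simp only [tensorFun, Pi.add_apply, hz, add_mul])
      (fun a f g => by
        rw [← MemLp.toLp_const_smul]
        refine MemLp.toLp_congr _ _ ?_
        filter_upwards [quasi_inl.ae (Lp.coeFn_smul a f)] with z hz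
        simp only [tensorFun, Pi.smul_apply, hz, smul_eq_mul, mul_assoc])
      (fun f g g' => by
        rw [← MemLp.toLp_add]
        refine MemLp.toLp_congr _ _ ?_
        filter_upwards [quasi_inr.ae (Lp.coeFn_add g g')] with z hz
        simp only [tensorFun, Pi.add_apply, hz, mul_add])
      (fun a f g => by
        rw [← MemLp.toLp_const_smul]
        refine MemLp.toLp_congr _ _ ?_
        filter_upwards [quasi_inr.ae (Lp.coeFn_smul a g)] with z hz
        simp only [tensorFun, Pi.smul_apply, hz, smul_eq_mul, mul_left_comm]))
    1 (fun f g => by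
      rw [LinearMap.mk₂_apply, Lp.norm_toLp, eLpNorm_tensorFun, ENNReal.toReal_mul, one_mul]
      rfl)

/-- The reduced state on the modes `ι`: the partial trace
`∑ₖ (1 ⊗ ⟨eₖ|) ρ (1 ⊗ |eₖ⟩)` over the modes `κ`. -/
def partialTraceRight (ρ : ModeSpace (ι ⊕ κ) →L[ℂ] ModeSpace (ι ⊕ κ)) :
    ModeSpace ι →L[ℂ] ModeSpace ι :=
  ∑' k : onbIndex (ModeSpace κ),
    ContinuousLinearMap.adjoint (tensor.flip (onb (ModeSpace κ) k)) ∘L ρ ∘L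
      tensor.flip (onb (ModeSpace κ) k)

/-- The reduced state on the modes `κ`: the partial trace
`∑ₖ (⟨eₖ| ⊗ 1) ρ (|eₖ⟩ ⊗ 1)` over the modes `ι`. -/
def partialTraceLeft (ρ : ModeSpace (ι ⊕ κ) →L[ℂ] ModeSpace (ι ⊕ κ)) :
    ModeSpace κ →L[ℂ] ModeSpace κ :=
  ∑' k : onbIndex (ModeSpace ι),
    ContinuousLinearMap.adjoint (tensor (onb (ModeSpace ι) k)) ∘L ρ ∘L
      tensor (onb (ModeSpace ι) k)

/-- The mutual information `S(ρ₁) + S(ρ₂) - S(ρ)` of `ρ = |ψ⟩⟨ψ|` across the bipartition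
`ι | κ`. -/
def mutualInformation (ψ : ModeSpace (ι ⊕ κ)) : ℝ :=
  (vonNeumannEntropy (partialTraceRight (pureState ψ))).toReal +
    (vonNeumannEntropy (partialTraceLeft (pureState ψ))).toReal -
    (vonNeumannEntropy (pureState ψ)).toReal

variable [DecidableEq ι] [DecidableEq κ]

/-- `U = U₁ ⊗ U₂` with Gaussian unitaries `U₁` on the modes `ι` and `U₂` on the modes `κ`. -/
def IsLocalGaussianUnitary (U : ModeSpace (ι ⊕ κ) ≃ₗᵢ[ℂ] ModeSpace (ι ⊕ κ)) : Prop :=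
  ∃ (U₁ : ModeSpace ι ≃ₗᵢ[ℂ] ModeSpace ι) (U₂ : ModeSpace κ ≃ₗᵢ[ℂ] ModeSpace κ),
    IsGaussianUnitary U₁ ∧ IsGaussianUnitary U₂ ∧
      ∀ f g, U (tensor f g) = tensor (U₁ f) (U₂ g)

/-- `2`-local Gaussian ergotropy for the bipartition `ι | κ`: the energy of the state minus the
least energy that is reached by products of Gaussian unitaries on the two parts. -/
def localErgotropy (ψ : ModeSpace (ι ⊕ κ)) : ℝ :=
  (energy ψ).toReal -
    (⨅ U : {U : ModeSpace (ι ⊕ κ) ≃ₗᵢ[ℂ] ModeSpace (ι ⊕ κ) // IsLocalGaussianUnitary U},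
      energy (U.1 ψ)).toReal

/-- The `2`-local ergotropic gap for the bipartition `ι | κ`. -/
def ergotropicGap (ψ : ModeSpace (ι ⊕ κ)) : ℝ :=
  globalErgotropy ψ - localErgotropy ψ

end TwoSystems

end GaussianModes

end

/-
The witnesses are two-mode squeezed vacua: `squeezedState he r` squeezes the pair of modes
`(i, e i)` with parameter `r i`. Expanding the Gaussian kernel in Hermite functions gives its
Schmidt decomposition in number states, with coefficients `∏ i, tanh (r i) ^ K i / cosh (r i)`.
Both reduced states are therefore thermal with mean photon numbers `n i = sinh (r i) ^ 2`, and
the mutual information is `2 * ∑ i, h (n i)`, where `h n = (n + 1) log (n + 1) - n log n`.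

The global infimum of the energy is the same for all these states, because they lie in one orbit
of the Gaussian unitaries. Local Gaussian unitaries do not lower their energy: the covariance
matrices of the two reduced states are in Williamson normal form, and a symplectic congruence
cannot decrease the trace of such a matrix. Hence the gap is a constant plus `2 * ∑ i, n i`.

Since `h` is not linear, `m * h 1 = h b` for some `b > m`: squeezing `m` pairs with `n = 1` and a
single pair with `n = b` gives the same mutual information but different gaps.
-/

noncomputable section

namespace GaussianModes

section Spectrum

variable {E : Type} [NormedAddCommGroup E] [InnerProductSpace ℂ E]

/-- The operator `ρ` is `∑ₙ pₙ |eₙ⟩⟨eₙ|`, the sum being taken in the weak operator topology. -/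
def IsDiagonalOn {α : Type*} (e : α → E) (p : α → ℝ) (ρ : E →L[ℂ] E) : Prop :=
  ∀ x g : E, HasSum (fun n => (p n : ℂ) * (inner ℂ (e n) g * inner ℂ x (e n))) (inner ℂ x (ρ g))

variable {α : Type*} {e : α → E} {p : α → ℝ} {ρ : E →L[ℂ] E}

theorem IsDiagonalOn.inner_basis (he : Orthonormal ℂ e) (h : IsDiagonalOn e p ρ) (n : α) (g : E) :
    inner ℂ (e n) (ρ g) = (p n : ℂ) * inner ℂ (e n) g := by
  have hsingle := hasSum_single (f := fun m => (p m : ℂ) * (inner ℂ (e m) g * inner ℂ (e n) (e m)))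
    n fun m hm => by rw [he.inner_eq_zero hm.symm, mul_zero, mul_zero]
  rw [(h (e n) g).unique hsingle, inner_self_eq_norm_sq_to_K, he.norm_eq_one]
  simp

theorem IsDiagonalOn.apply_basis (he : Orthonormal ℂ e) (h : IsDiagonalOn e p ρ) (n : α) :
    ρ (e n) = (p n : ℂ) • e n := by
  refine ext_inner_left ℂ fun x => ?_
  have hsingle := hasSum_single (f := fun m => (p m : ℂ) * (inner ℂ (e m) (e n) * inner ℂ x (e m)))
    n fun m hm => by rw [he.inner_eq_zero hm, zero_mul, mul_zero]
  rw [(h x (e n)).unique hsingle, inner_self_eq_norm_sq_to_K, he.norm_eq_one, inner_smul_right]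
  simp

theorem IsDiagonalOn.inner_basis_eq_zero (he : Orthonormal ℂ e) (h : IsDiagonalOn e p ρ) {q : ℝ}
    {g : E} (hg : ρ g = (q : ℂ) • g) {n : α} (hn : p n ≠ q) : inner ℂ (e n) g = 0 := by
  have hpq : (p n : ℂ) * inner ℂ (e n) g = q * inner ℂ (e n) g := by
    rw [← h.inner_basis he, hg, inner_smul_right]
  exact (mul_eq_mul_right_iff.1 hpq).resolve_left (mod_cast hn)

theorem IsDiagonalOn.eq_sum_of_apply_eq_smul (he : Orthonormal ℂ e) (h : IsDiagonalOn e p ρ)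
    {q : ℝ} (hq : q ≠ 0) (hfin : {n | p n = q}.Finite) {g : E} (hg : ρ g = (q : ℂ) • g) :
    g = ∑ n ∈ hfin.toFinset, inner ℂ (e n) g • e n := by
  refine ext_inner_left ℂ fun x => mul_left_cancel₀ (Complex.ofReal_ne_zero.2 hq) ?_
  have hsum : HasSum (fun n => (p n : ℂ) * (inner ℂ (e n) g * inner ℂ x (e n))) _ :=
    hasSum_sum_of_ne_finset_zero (s := hfin.toFinset) fun n hn => by
      rw [h.inner_basis_eq_zero he hg (by simpa using hn), zero_mul, mul_zero]
  rw [← inner_smul_right, ← hg, (h x g).unique hsum, inner_sum, Finset.mul_sum]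
  refine Finset.sum_congr rfl fun n hn => ?_
  rw [inner_smul_right, show p n = q by simpa using hn]

theorem IsDiagonalOn.eigenspace_eq_span (he : Orthonormal ℂ e) (h : IsDiagonalOn e p ρ) {q : ℝ}
    (hq : q ≠ 0) (hfin : {n | p n = q}.Finite) :
    Module.End.eigenspace (ρ : E →ₗ[ℂ] E) (q : ℂ) =
      Submodule.span ℂ (Set.range fun n : {n | p n = q} => e n) := by
  apply le_antisymm
  · intro g hg
    rw [h.eq_sum_of_apply_eq_smul he hq hfin (Module.End.mem_eigenspace_iff.1 hg)]
    exact Submodule.sum_mem _ fun n hn => Submodule.smul_mem _ _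
      (Submodule.subset_span ⟨⟨n, by simpa using hn⟩, rfl⟩)
  · rw [Submodule.span_le]
    rintro _ ⟨⟨n, rfl⟩, rfl⟩
    exact Module.End.mem_eigenspace_iff.2 (h.apply_basis he n)

theorem IsDiagonalOn.finrank_eigenspace (he : Orthonormal ℂ e) (h : IsDiagonalOn e p ρ) {q : ℝ}
    (hq : q ≠ 0) (hfin : {n | p n = q}.Finite) :
    Module.finrank ℂ (Module.End.eigenspace (ρ : E →ₗ[ℂ] E) (q : ℂ)) = {n | p n = q}.ncard := by
  have : Fintype {n | p n = q} := hfin.fintype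
  have hli : LinearIndependent ℂ fun n : {n | p n = q} => e n :=
    he.linearIndependent.comp _ Subtype.val_injective
  rw [h.eigenspace_eq_span he hq hfin, finrank_span_eq_card hli, ← Nat.card_eq_fintype_card,
    Nat.card_coe_set_eq]

theorem IsDiagonalOn.vonNeumannEntropy_eq (he : Orthonormal ℂ e) (h : IsDiagonalOn e p ρ)
    (hp : Summable p) :
    vonNeumannEntropy ρ = ∑' n, ENNReal.ofReal (Real.negMulLog (p n)) := by
  rw [vonNeumannEntropy, ← ENNReal.tsum_fiberwise _ p]
  refine tsum_congr fun q => ?_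
  rcases eq_or_ne q 0 with rfl | hq
  · have hzero : ∀ n : (p ⁻¹' {(0 : ℝ)} : Set α), p n = 0 := fun n => n.2
    simp [hzero]
  have hfin : {n | p n = q}.Finite := by
    have hne : ∀ᶠ n in Filter.cofinite, p n ≠ q :=
      hp.tendsto_cofinite_zero.eventually_ne hq.symm
    simpa [Filter.eventually_cofinite] using hne
  have hconst : ∀ n : (p ⁻¹' {q} : Set α), ENNReal.ofReal (Real.negMulLog (p n)) =
      ENNReal.ofReal (Real.negMulLog q) := fun n => by rw [show p n = q from n.2]
  rw [h.finrank_eigenspace he hq hfin, tsum_congr hconst, ENNReal.tsum_set_const,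
    show p ⁻¹' {q} = {n | p n = q} from rfl, ← hfin.cast_ncard_eq, ENat.toENNReal_coe]

theorem isDiagonalOn_pureState (ψ : E) :
    IsDiagonalOn (fun _ : Unit => ψ) (fun _ => 1) (pureState ψ) := by
  intro x g
  simp [pureState]

theorem vonNeumannEntropy_pureState {ψ : E} (hψ : ‖ψ‖ = 1) :
    vonNeumannEntropy (pureState ψ) = 0 := by
  have hon : Orthonormal ℂ fun _ : Unit => ψ :=
    ⟨fun _ => hψ, fun i j hij => absurd (Subsingleton.elim i j) hij⟩
  simp [(isDiagonalOn_pureState ψ).vonNeumannEntropy_eq hon (hasSum_fintype _).summable]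

end Spectrum

section PartialTrace

open ContinuousLinearMap (adjoint)

/-- A bounded bilinear map that, like the tensor product of Hilbert spaces, multiplies inner
products. -/
def IsTensorIsometry {E F G : Type*} [NormedAddCommGroup E] [InnerProductSpace ℂ E]
    [NormedAddCommGroup F] [InnerProductSpace ℂ F] [NormedAddCommGroup G] [InnerProductSpace ℂ G]
    (B : E →L[ℂ] F →L[ℂ] G) : Prop :=
  ∀ f f' g g', inner ℂ (B f g) (B f' g') = inner ℂ f f' * inner ℂ g g'

variable {E F G : Type} [NormedAddCommGroup E] [InnerProductSpace ℂ E]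
  [NormedAddCommGroup F] [InnerProductSpace ℂ F] [NormedAddCommGroup G] [InnerProductSpace ℂ G]
  {B : E →L[ℂ] F →L[ℂ] G}

theorem IsTensorIsometry.flip (hB : IsTensorIsometry B) : IsTensorIsometry B.flip :=
  fun f f' g g' => (hB g g' f f').trans (mul_comm _ _)

theorem IsTensorIsometry.norm_sum_sq (hB : IsTensorIsometry B) {β : Type*} {b : β → F}
    (hb : Orthonormal ℂ b) (v : β → E) (s : Finset β) :
    ‖∑ k ∈ s, B (v k) (b k)‖ ^ 2 = ∑ k ∈ s, ‖v k‖ ^ 2 := by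
  classical
  have hinner : inner ℂ (∑ k ∈ s, B (v k) (b k)) (∑ k ∈ s, B (v k) (b k)) =
      ∑ k ∈ s, inner ℂ (v k) (v k) := by
    simp only [sum_inner, inner_sum]
    refine Finset.sum_congr rfl fun k hk => ?_
    simp only [hB _ _ _ _, orthonormal_iff_ite.1 hb, mul_ite, mul_one, mul_zero]
    rw [Finset.sum_ite_eq', if_pos hk]
  simp only [inner_self_eq_norm_sq_to_K] at hinner
  exact_mod_cast hinner

variable [CompleteSpace G] {ψ : G} {α : Type*} {e : α → E} {f : α → F} {s : α → ℝ}

theorem IsTensorIsometry.hasSum_adjoint_schmidt [CompleteSpace F] (hB : IsTensorIsometry B)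
    (hψ : HasSum (fun n => (s n : ℂ) • B (e n) (f n)) ψ) (x : E) :
    HasSum (fun n => ((s n : ℂ) * inner ℂ x (e n)) • f n) (adjoint (B x) ψ) := by
  convert hψ.mapL (adjoint (B x)) using 2 with n
  refine ext_inner_left ℂ fun z => ?_
  rw [map_smul, inner_smul_right, inner_smul_right, ContinuousLinearMap.adjoint_inner_right,
    hB x (e n) z (f n), mul_assoc]

theorem IsTensorIsometry.inner_adjoint_schmidt [CompleteSpace F] (hB : IsTensorIsometry B)
    (hf : Orthonormal ℂ f) (hψ : HasSum (fun n => (s n : ℂ) • B (e n) (f n)) ψ) (x : E) (m : α) :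
    inner ℂ (adjoint (B x) ψ) (f m) = (s m : ℂ) * inner ℂ (e m) x := by
  have hinner := (hB.hasSum_adjoint_schmidt hψ x).mapL (innerSL ℂ (f m))
  have hsingle := hasSum_single
    (f := fun n => innerSL ℂ (f m) (((s n : ℂ) * inner ℂ x (e n)) • f n)) m fun n hn => by
      rw [innerSL_apply_apply, inner_smul_right, hf.inner_eq_zero hn.symm, mul_zero]
  have hconj := hinner.unique hsingle
  rw [innerSL_apply_apply, innerSL_apply_apply, inner_smul_right, inner_self_eq_norm_sq_to_K,
    hf.norm_eq_one] at hconj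
  rw [← inner_conj_symm, hconj]
  simp

theorem IsTensorIsometry.sum_norm_sq_adjoint_le [CompleteSpace E] (hB : IsTensorIsometry B)
    {β : Type*} {b : β → F} (hb : Orthonormal ℂ b) (ψ : G) (s : Finset β) :
    ∑ k ∈ s, ‖adjoint (B.flip (b k)) ψ‖ ^ 2 ≤ ‖ψ‖ ^ 2 := by
  set v : β → E := fun k => adjoint (B.flip (b k)) ψ
  set φ : G := ∑ k ∈ s, B (v k) (b k)
  have hφψ : RCLike.re (inner ℂ φ ψ) = ‖φ‖ ^ 2 := by
    simp only [φ, hB.norm_sum_sq hb, sum_inner, map_sum]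
    refine Finset.sum_congr rfl fun k _ => ?_
    rw [← B.flip_apply, ← ContinuousLinearMap.adjoint_inner_right, inner_self_eq_norm_sq]
  have hdiff := @norm_sub_sq ℂ _ _ _ _ φ ψ
  rw [hφψ] at hdiff
  rw [← hB.norm_sum_sq hb]
  linarith [sq_nonneg ‖φ - ψ‖]

variable [CompleteSpace E] [CompleteSpace F] {β : Type*} (b : HilbertBasis β ℂ F)

theorem IsTensorIsometry.inner_partialTrace_pureState (hB : IsTensorIsometry B) (ψ : G) (x g : E) :
    inner ℂ x ((∑' k, adjoint (B.flip (b k)) ∘L pureState ψ ∘L B.flip (b k)) g) =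
      inner ℂ (adjoint (B g) ψ) (adjoint (B x) ψ) := by
  have hterm : ∀ k, adjoint (B.flip (b k)) ∘L pureState ψ ∘L B.flip (b k) =
      InnerProductSpace.rankOne ℂ (adjoint (B.flip (b k)) ψ) (adjoint (B.flip (b k)) ψ) := fun k =>
    by rw [pureState, InnerProductSpace.rankOne_comp, InnerProductSpace.comp_rankOne]
  have hsum : Summable fun k => adjoint (B.flip (b k)) ∘L pureState ψ ∘L B.flip (b k) := by
    refine Summable.of_norm ?_
    simp only [hterm, InnerProductSpace.norm_rankOne, ← sq]
    exact summable_of_sum_le (fun _ => sq_nonneg _) (hB.sum_norm_sq_adjoint_le b.orthonormal ψ)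
  refine ((hsum.hasSum.mapL (ContinuousLinearMap.apply ℂ E g)).mapL (innerSL ℂ x)).unique ?_
  convert b.hasSum_inner_mul_inner (adjoint (B g) ψ) (adjoint (B x) ψ) using 2 with k
  simp only [ContinuousLinearMap.adjoint_inner_left, ContinuousLinearMap.adjoint_inner_right,
    hterm, ContinuousLinearMap.apply_apply, InnerProductSpace.rankOne_apply,
    innerSL_apply_apply, inner_smul_right, ContinuousLinearMap.flip_apply]

theorem IsTensorIsometry.isDiagonalOn_partialTrace (hB : IsTensorIsometry B)
    (hf : Orthonormal ℂ f) (hψ : HasSum (fun n => (s n : ℂ) • B (e n) (f n)) ψ) :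
    IsDiagonalOn e (fun n => s n ^ 2)
      (∑' k, adjoint (B.flip (b k)) ∘L pureState ψ ∘L B.flip (b k)) := by
  intro x g
  rw [hB.inner_partialTrace_pureState b ψ x g]
  have hinner := (hB.hasSum_adjoint_schmidt hψ x).mapL (innerSL ℂ (adjoint (B g) ψ))
  simp only [innerSL_apply_apply, inner_smul_right, hB.inner_adjoint_schmidt hf hψ g] at hinner
  refine hinner.congr_fun fun n => ?_
  push_cast
  ring

end PartialTrace

section Weyl

variable {ι : Type} [Fintype ι]

theorem coeFn_weyl (c : ι ⊕ ι → ℝ) (ψ : ModeSpace ι) :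
    (weyl c ψ : (ι → ℝ) → ℂ) =ᵐ[volume] weylFun c ψ :=
  MemLp.coeFn_toLp _

theorem weyl_add (c : ι ⊕ ι → ℝ) (φ ψ : ModeSpace ι) : weyl c (φ + ψ) = weyl c φ + weyl c ψ := by
  refine Lp.ext ?_
  filter_upwards [coeFn_weyl c (φ + ψ), coeFn_weyl c φ, coeFn_weyl c ψ,
    Lp.coeFn_add (weyl c φ) (weyl c ψ),
    (quasiMeasurePreserving_add_right volume (c ∘ Sum.inr)).ae (Lp.coeFn_add φ ψ)]
    with x hsum hφ hψ hadd hshift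
  rw [hsum, hadd, Pi.add_apply, hφ, hψ, weylFun, weylFun, weylFun, hshift, Pi.add_apply, mul_add]

theorem weyl_smul (c : ι ⊕ ι → ℝ) (a : ℂ) (ψ : ModeSpace ι) : weyl c (a • ψ) = a • weyl c ψ := by
  refine Lp.ext ?_
  filter_upwards [coeFn_weyl c (a • ψ), coeFn_weyl c ψ, Lp.coeFn_smul a (weyl c ψ),
    (quasiMeasurePreserving_add_right volume (c ∘ Sum.inr)).ae (Lp.coeFn_smul a ψ)]
    with x hsmul hψ hcoe hshift
  rw [hsmul, hcoe, Pi.smul_apply, hψ, weylFun, weylFun, hshift, Pi.smul_apply, smul_eq_mul,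
    smul_eq_mul, mul_left_comm]

theorem norm_weyl (c : ι ⊕ ι → ℝ) (ψ : ModeSpace ι) : ‖weyl c ψ‖ = ‖ψ‖ := by
  rw [weyl, Lp.norm_toLp, Lp.norm_def]
  congr 1
  rw [← eLpNorm_comp_measurePreserving (Lp.aestronglyMeasurable ψ)
    (measurePreserving_add_right volume (c ∘ Sum.inr))]
  refine eLpNorm_congr_norm_ae (Filter.Eventually.of_forall fun x => ?_)
  rw [weylFun, norm_mul, mul_comm Complex.I, Complex.norm_exp_ofReal_mul_I, one_mul]
  rfl

/-- The Weyl operator as a linear isometry. -/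
def weylₗᵢ (c : ι ⊕ ι → ℝ) : ModeSpace ι →ₗᵢ[ℂ] ModeSpace ι where
  toFun := weyl c
  map_add' := weyl_add c
  map_smul' := weyl_smul c
  norm_map' := norm_weyl c

theorem norm_weyl_sub_sq (c : ι ⊕ ι → ℝ) {ψ : ModeSpace ι} (hψ : ‖ψ‖ = 1) :
    ‖weyl c ψ - ψ‖ ^ 2 = 2 - 2 * (inner ℂ ψ (weyl c ψ)).re := by
  rw [@norm_sub_sq ℂ, norm_weyl, hψ, inner_re_symm, RCLike.re_to_complex]
  ring

end Weyl

section PhaseSpace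

variable {ι κ : Type}

/-- The quadratures of the modes `ι` among those of the modes `ι ⊕ κ`. -/
def quadInl : ι ⊕ ι → (ι ⊕ κ) ⊕ (ι ⊕ κ) := Sum.map Sum.inl Sum.inl

/-- The quadratures of the modes `κ` among those of the modes `ι ⊕ κ`. -/
def quadInr : κ ⊕ κ → (ι ⊕ κ) ⊕ (ι ⊕ κ) := Sum.map Sum.inr Sum.inr

/-- The phase space vector of the modes `ι ⊕ κ` with the given restrictions to `ι` and to `κ`. -/
def joinPhase (a : ι ⊕ ι → ℝ) (b : κ ⊕ κ → ℝ) : (ι ⊕ κ) ⊕ (ι ⊕ κ) → ℝ :=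
  Sum.elim (Sum.elim (a ∘ Sum.inl) (b ∘ Sum.inl)) (Sum.elim (a ∘ Sum.inr) (b ∘ Sum.inr))

theorem joinPhase_comp_quadInl (a : ι ⊕ ι → ℝ) (b : κ ⊕ κ → ℝ) : joinPhase a b ∘ quadInl = a := by
  ext (i | i) <;> rfl

theorem joinPhase_comp_quadInr (a : ι ⊕ ι → ℝ) (b : κ ⊕ κ → ℝ) : joinPhase a b ∘ quadInr = b := by
  ext (j | j) <;> rfl

end PhaseSpace

section Tensor

variable {ι κ : Type} [Fintype ι] [Fintype κ]

theorem coeFn_tensor (f : ModeSpace ι) (g : ModeSpace κ) :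
    (tensor f g : (ι ⊕ κ → ℝ) → ℂ) =ᵐ[volume] tensorFun f g :=
  MemLp.coeFn_toLp (memLp_tensorFun f g)

theorem integral_sum_pi {E : Type*} [NormedAddCommGroup E] [NormedSpace ℝ E]
    (f : (ι ⊕ κ → ℝ) → E) :
    ∫ z, f z = ∫ w : (ι → ℝ) × (κ → ℝ), f (Sum.elim w.1 w.2) := by
  rw [← (volume_measurePreserving_sumPiEquivProdPi_symm (fun _ : ι ⊕ κ => ℝ)).integral_comp
    (MeasurableEquiv.measurableEmbedding _)]
  refine integral_congr_ae (Filter.Eventually.of_forall fun w => ?_)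
  exact congrArg f (funext fun j => by cases j <;> rfl)

theorem integral_tensorFun (f : (ι → ℝ) → ℂ) (g : (κ → ℝ) → ℂ) :
    ∫ z, tensorFun f g z = (∫ x, f x) * ∫ y, g y := by
  rw [integral_sum_pi, ← integral_prod_mul]
  rfl

theorem isTensorIsometry_tensor :
    IsTensorIsometry (tensor : ModeSpace ι →L[ℂ] ModeSpace κ →L[ℂ] ModeSpace (ι ⊕ κ)) := by
  intro f f' g g'
  rw [L2.inner_def, L2.inner_def, L2.inner_def, ← integral_tensorFun]
  refine integral_congr_ae ?_
  filter_upwards [coeFn_tensor f g, coeFn_tensor f' g'] with z h h'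
  rw [h, h']
  simp only [tensorFun, RCLike.inner_apply, map_mul]
  ring

theorem weyl_tensor (c : (ι ⊕ κ) ⊕ (ι ⊕ κ) → ℝ) (f : ModeSpace ι) (g : ModeSpace κ) :
    weyl c (tensor f g) = tensor (weyl (c ∘ quadInl) f) (weyl (c ∘ quadInr) g) := by
  refine Lp.ext ?_
  filter_upwards [coeFn_weyl c (tensor f g),
    coeFn_tensor (weyl (c ∘ quadInl) f) (weyl (c ∘ quadInr) g),
    quasi_inl.ae (coeFn_weyl (c ∘ quadInl) f), quasi_inr.ae (coeFn_weyl (c ∘ quadInr) g),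
    (quasiMeasurePreserving_add_right volume (c ∘ Sum.inr)).ae (coeFn_tensor f g)]
    with z hweyl htensor hf hg hshift
  rw [hweyl, htensor, weylFun, hshift, tensorFun, tensorFun, hf, hg, weylFun, weylFun,
    mul_mul_mul_comm, ← Complex.exp_add, ← mul_add, ← Complex.ofReal_add]
  refine congrArg₂ (· * ·) (congrArg (fun a : ℝ => Complex.exp (Complex.I * (a : ℂ))) ?_) rfl
  simp only [Fintype.sum_sum_type, quadInl, quadInr, Function.comp_apply, Sum.map_inl, Sum.map_inr]
  ring

variable (ι κ) in
/-- The closed span of the product vectors; it contains every vector that has a Schmidt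
decomposition. -/
def productSpan : Submodule ℂ (ModeSpace (ι ⊕ κ)) :=
  (Submodule.span ℂ (Set.range fun p : ModeSpace ι × ModeSpace κ =>
    tensor p.1 p.2)).topologicalClosure

theorem mem_productSpan_of_hasSum {α : Type*} {s : α → ℂ} {e : α → ModeSpace ι}
    {f : α → ModeSpace κ} {ψ : ModeSpace (ι ⊕ κ)}
    (hψ : HasSum (fun n => s n • tensor (e n) (f n)) ψ) : ψ ∈ productSpan ι κ :=
  (Submodule.isClosed_topologicalClosure _).mem_of_tendsto hψ <| Filter.Eventually.of_forall
    fun _ => Submodule.sum_mem _ fun n _ => Submodule.smul_mem _ _ <|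
      Submodule.le_topologicalClosure _ (Submodule.subset_span ⟨(e n, f n), rfl⟩)

end Tensor

section GaussianUnitary

variable {ι : Type} [Fintype ι] [DecidableEq ι]

theorem IsGaussianUnitary.refl : IsGaussianUnitary (LinearIsometryEquiv.refl ℂ (ModeSpace ι)) :=
  ⟨1, Submonoid.one_mem _, 0, fun c φ => by simp⟩

theorem IsGaussianUnitary.trans {U W : ModeSpace ι ≃ₗᵢ[ℂ] ModeSpace ι} (hW : IsGaussianUnitary W)
    (hU : IsGaussianUnitary U) : IsGaussianUnitary (W.trans U) := by
  obtain ⟨S, hS, d, hU⟩ := hU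
  obtain ⟨S', hS', d', hW⟩ := hW
  refine ⟨S * S', Submonoid.mul_mem _ hS hS', d + S *ᵥ d', fun c φ => ?_⟩
  have hphase : c ⬝ᵥ (d + S *ᵥ d') = c ⬝ᵥ d + (Sᵀ *ᵥ c) ⬝ᵥ d' := by
    rw [dotProduct_add, Matrix.dotProduct_mulVec, Matrix.mulVec_transpose]
  rw [LinearIsometryEquiv.trans_apply, hU, hW, map_smul, smul_smul, ← Complex.exp_add,
    LinearIsometryEquiv.trans_apply, Matrix.mulVec_mulVec, Matrix.transpose_mul, ← mul_add,
    ← Complex.ofReal_add, hphase]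

theorem IsGaussianUnitary.symm {U : ModeSpace ι ≃ₗᵢ[ℂ] ModeSpace ι} (hU : IsGaussianUnitary U) :
    IsGaussianUnitary U.symm := by
  obtain ⟨S, hS, d, hU⟩ := hU
  set T := (⟨S, hS⟩ : Matrix.symplecticGroup ι ℝ)⁻¹
  have hTS : T.1 * S = 1 :=
    congrArg Subtype.val (inv_mul_cancel (⟨S, hS⟩ : Matrix.symplecticGroup ι ℝ))
  refine ⟨T, T.2, -(T.1 *ᵥ d), fun c φ => U.injective ?_⟩
  have hconj := hU (T.1ᵀ *ᵥ c) (U.symm φ)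
  rw [Matrix.mulVec_mulVec, ← Matrix.transpose_mul, hTS, Matrix.transpose_one, Matrix.one_mulVec,
    U.apply_symm_apply] at hconj
  rw [map_smul, U.apply_symm_apply, hconj, smul_smul, ← Complex.exp_add, dotProduct_neg,
    Matrix.dotProduct_mulVec, ← Matrix.mulVec_transpose]
  simp

theorem iInf_energy_orbit {W : ModeSpace ι ≃ₗᵢ[ℂ] ModeSpace ι} (hW : IsGaussianUnitary W)
    (ψ : ModeSpace ι) :
    ⨅ U : {U : ModeSpace ι ≃ₗᵢ[ℂ] ModeSpace ι // IsGaussianUnitary U}, energy (U.1 (W ψ)) =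
      ⨅ U : {U : ModeSpace ι ≃ₗᵢ[ℂ] ModeSpace ι // IsGaussianUnitary U}, energy (U.1 ψ) := by
  refine le_antisymm (le_iInf fun U => ?_) (le_iInf fun U => ?_)
  · refine iInf_le_of_le ⟨W.symm.trans U.1, hW.symm.trans U.2⟩ ?_
    rw [LinearIsometryEquiv.trans_apply, W.symm_apply_apply]
  · exact iInf_le_of_le ⟨W.trans U.1, hW.trans U.2⟩ le_rfl

theorem isUnit_det_of_abs_eq_one {M : Matrix ι ι ℝ} (hM : |M.det| = 1) : IsUnit M.det :=
  isUnit_iff_ne_zero.2 (abs_pos.1 (hM ▸ one_pos))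

theorem measurePreserving_mulVec {M : Matrix ι ι ℝ} (hM : |M.det| = 1) :
    MeasurePreserving (fun x : ι → ℝ => M *ᵥ x) volume volume := by
  refine ⟨by fun_prop, ?_⟩
  have hmap := Real.map_matrix_volume_pi_eq_smul_volume_pi (isUnit_det_of_abs_eq_one hM).ne_zero
  rwa [abs_inv, hM, inv_one, ENNReal.ofReal_one, one_smul] at hmap

/-- The unitary `f ↦ f ∘ M` of a volume preserving linear map `M` of configuration space. -/
def pullback (M : Matrix ι ι ℝ) (hM : |M.det| = 1) : ModeSpace ι ≃ₗᵢ[ℂ] ModeSpace ι :=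
  LinearIsometryEquiv.ofSurjective
    (Lp.compMeasurePreservingₗᵢ ℂ (fun x : ι → ℝ => M *ᵥ x) (measurePreserving_mulVec hM)) <| by
    have hM' : |M⁻¹.det| = 1 := by
      rw [Matrix.det_nonsing_inv, Ring.inverse_eq_inv', abs_inv, hM, inv_one]
    intro f
    refine ⟨Lp.compMeasurePreserving _ (measurePreserving_mulVec hM') f, Lp.ext ?_⟩
    filter_upwards [Lp.coeFn_compMeasurePreserving
        (Lp.compMeasurePreserving _ (measurePreserving_mulVec hM') f) (measurePreserving_mulVec hM),
      (measurePreserving_mulVec hM).quasiMeasurePreserving.ae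
        (Lp.coeFn_compMeasurePreserving f (measurePreserving_mulVec hM'))] with x hx hx'
    refine hx.trans ?_
    rw [Function.comp_apply, hx', Function.comp_apply, Matrix.mulVec_mulVec,
      Matrix.nonsing_inv_mul _ (isUnit_det_of_abs_eq_one hM), Matrix.one_mulVec]

variable {M : Matrix ι ι ℝ} (hM : |M.det| = 1)

theorem coeFn_pullback (f : ModeSpace ι) :
    (pullback M hM f : (ι → ℝ) → ℂ) =ᵐ[volume] fun x => f (M *ᵥ x) :=
  Lp.coeFn_compMeasurePreserving f (measurePreserving_mulVec hM)

theorem weyl_pullback (c : ι ⊕ ι → ℝ) (φ : ModeSpace ι) :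
    weyl c (pullback M hM φ) =
      pullback M hM (weyl (Sum.elim (M⁻¹ᵀ *ᵥ (c ∘ Sum.inl)) (M *ᵥ (c ∘ Sum.inr))) φ) := by
  set c' : ι ⊕ ι → ℝ := Sum.elim (M⁻¹ᵀ *ᵥ (c ∘ Sum.inl)) (M *ᵥ (c ∘ Sum.inr))
  have hdot : ∀ x : ι → ℝ, ∑ i, c' (Sum.inl i) * (M *ᵥ x) i = ∑ i, c (Sum.inl i) * x i := by
    intro x
    change (M⁻¹ᵀ *ᵥ (c ∘ Sum.inl)) ⬝ᵥ (M *ᵥ x) = (c ∘ Sum.inl) ⬝ᵥ x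
    rw [Matrix.mulVec_transpose, ← Matrix.dotProduct_mulVec, Matrix.mulVec_mulVec,
      Matrix.nonsing_inv_mul _ (isUnit_det_of_abs_eq_one hM), Matrix.one_mulVec]
  refine Lp.ext ?_
  filter_upwards [coeFn_weyl c (pullback M hM φ), coeFn_pullback hM (weyl c' φ),
    (measurePreserving_mulVec hM).quasiMeasurePreserving.ae (coeFn_weyl c' φ),
    (quasiMeasurePreserving_add_right volume (c ∘ Sum.inr)).ae (coeFn_pullback hM φ)]
    with x hweyl hpull hφ hshift
  rw [hweyl, hpull, hφ, weylFun, weylFun, hshift, hdot, Matrix.mulVec_add]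
  exact congrArg (fun a : ℝ => Complex.exp (Complex.I * ((_ + a / 2 : ℝ) : ℂ)) * _)
    (hdot (c ∘ Sum.inr)).symm

theorem isGaussianUnitary_pullback : IsGaussianUnitary (pullback M hM) := by
  refine ⟨Matrix.fromBlocks M⁻¹ 0 0 Mᵀ, ?_, 0, fun c φ => ?_⟩
  · rw [SymplecticGroup.fromBlocks_mem_iff]
    simp [Matrix.mul_nonsing_inv _ (isUnit_det_of_abs_eq_one hM), ← Matrix.transpose_mul]
  · rw [weyl_pullback, Matrix.fromBlocks_transpose, Matrix.fromBlocks_mulVec]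
    simp

end GaussianUnitary

section LocalUnitary

variable {ι κ : Type} [Fintype ι] [Fintype κ] [DecidableEq ι] [DecidableEq κ]

theorem IsLocalGaussianUnitary.refl :
    IsLocalGaussianUnitary (LinearIsometryEquiv.refl ℂ (ModeSpace (ι ⊕ κ))) :=
  ⟨.refl ℂ _, .refl ℂ _, .refl, .refl, fun _ _ => rfl⟩

theorem IsLocalGaussianUnitary.exists_weyl {U : ModeSpace (ι ⊕ κ) ≃ₗᵢ[ℂ] ModeSpace (ι ⊕ κ)}
    (hU : IsLocalGaussianUnitary U) :
    ∃ S₁ ∈ Matrix.symplecticGroup ι ℝ, ∃ S₂ ∈ Matrix.symplecticGroup κ ℝ,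
      ∃ d : (ι ⊕ κ) ⊕ (ι ⊕ κ) → ℝ, ∀ (c : (ι ⊕ κ) ⊕ (ι ⊕ κ) → ℝ), ∀ ψ ∈ productSpan ι κ,
        weyl c (U ψ) = Complex.exp (Complex.I * ((c ⬝ᵥ d : ℝ) : ℂ)) •
          U (weyl (joinPhase (S₁ᵀ *ᵥ (c ∘ quadInl)) (S₂ᵀ *ᵥ (c ∘ quadInr))) ψ) := by
  obtain ⟨U₁, U₂, ⟨S₁, hS₁, d₁, h₁⟩, ⟨S₂, hS₂, d₂, h₂⟩, hU⟩ := hU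
  refine ⟨S₁, hS₁, S₂, hS₂, joinPhase d₁ d₂, fun c ψ hψ => ?_⟩
  set c' := joinPhase (S₁ᵀ *ᵥ (c ∘ quadInl)) (S₂ᵀ *ᵥ (c ∘ quadInr))
  have hphase : c ⬝ᵥ joinPhase d₁ d₂ = (c ∘ quadInl) ⬝ᵥ d₁ + (c ∘ quadInr) ⬝ᵥ d₂ := by
    simp only [dotProduct, joinPhase, quadInl, quadInr, Fintype.sum_sum_type, Function.comp_apply,
      Sum.map_inl, Sum.map_inr, Sum.elim_inl, Sum.elim_inr]
    ring
  refine ContinuousLinearMap.eqOn_closure_span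
    (f := (weylₗᵢ c).toContinuousLinearMap ∘L
      (U.toContinuousLinearEquiv : ModeSpace (ι ⊕ κ) →L[ℂ] ModeSpace (ι ⊕ κ)))
    (g := Complex.exp (Complex.I * ((c ⬝ᵥ joinPhase d₁ d₂ : ℝ) : ℂ)) •
      ((U.toContinuousLinearEquiv : ModeSpace (ι ⊕ κ) →L[ℂ] ModeSpace (ι ⊕ κ)) ∘L
        (weylₗᵢ c').toContinuousLinearMap)) ?_ hψ
  rintro _ ⟨⟨f, g⟩, rfl⟩
  change weyl c (U (tensor f g)) = Complex.exp _ • U (weyl c' (tensor f g))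
  rw [hU, weyl_tensor, weyl_tensor, joinPhase_comp_quadInl, joinPhase_comp_quadInr, hU, h₁, h₂,
    map_smul, map_smul, smul_apply, smul_smul, ← Complex.exp_add, ← mul_add,
    ← Complex.ofReal_add, hphase, add_comm]

end LocalUnitary

section Hermite

open Polynomial

theorem derivative_hermite_succ (n : ℕ) :
    derivative (hermite (n + 1)) = (n + 1 : ℤ[X]) * hermite n := by
  induction n with
  | zero => simp
  | succ n ih =>
    rw [hermite_succ (n + 1), derivative_sub, derivative_mul, ih, derivative_X, derivative_mul,
      ← Nat.cast_succ, derivative_natCast, hermite_succ n]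
    push_cast
    ring

/-- The probabilists' Hermite polynomial with real coefficients. -/
def realHermite (n : ℕ) : ℝ[X] := (hermite n).map (Int.castRingHom ℝ)

theorem realHermite_zero : realHermite 0 = 1 := by simp [realHermite]

theorem realHermite_succ (n : ℕ) :
    realHermite (n + 1) = X * realHermite n - derivative (realHermite n) := by
  simp [realHermite, hermite_succ, derivative_map]

theorem derivative_realHermite_succ (n : ℕ) :
    derivative (realHermite (n + 1)) = C (n + 1 : ℝ) * realHermite n := by
  rw [realHermite, derivative_map, derivative_hermite_succ]
  simp [realHermite]

theorem integrable_eval_mul_gaussian (p : ℝ[X]) :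
    Integrable fun x : ℝ => p.eval x * Real.exp (-(x ^ 2 / 2)) := by
  induction p using Polynomial.induction_on' with
  | add p q hp hq =>
    refine (hp.add hq).congr (Filter.Eventually.of_forall fun x => ?_)
    simp only [Pi.add_apply, eval_add, add_mul]
  | monomial n a =>
    have hmoment := (integrable_rpow_mul_exp_neg_mul_sq (b := 1 / 2) (by norm_num) (s := n)
      (neg_one_lt_zero.trans_le n.cast_nonneg)).const_mul a
    refine hmoment.congr (Filter.Eventually.of_forall fun x => ?_)
    simp only [Real.rpow_natCast, eval_monomial]
    ring_nf

/-- Integration of polynomials against the Gaussian weight `exp (-x² / 2)`, which is not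
normalized: its total mass is `√(2π)`. -/
def gaussianIntegral : ℝ[X] →ₗ[ℝ] ℝ where
  toFun p := ∫ x : ℝ, p.eval x * Real.exp (-(x ^ 2 / 2))
  map_add' p q := by
    simp only [eval_add, add_mul]
    exact integral_add (integrable_eval_mul_gaussian p) (integrable_eval_mul_gaussian q)
  map_smul' a p := by
    simp only [eval_smul, smul_eq_mul, mul_assoc, RingHom.id_apply]
    exact integral_const_mul _ _

theorem gaussianIntegral_apply (p : ℝ[X]) :
    gaussianIntegral p = ∫ x : ℝ, p.eval x * Real.exp (-(x ^ 2 / 2)) := rfl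

theorem gaussianIntegral_C_mul (a : ℝ) (p : ℝ[X]) :
    gaussianIntegral (C a * p) = a * gaussianIntegral p := by
  rw [C_mul', map_smul, smul_eq_mul]

theorem gaussianIntegral_one : gaussianIntegral 1 = √(2 * Real.pi) := by
  have hgauss := integral_gaussian (1 / 2)
  rw [show Real.pi / (1 / 2) = 2 * Real.pi by ring] at hgauss
  rw [← hgauss, gaussianIntegral_apply]
  refine integral_congr_ae (Filter.Eventually.of_forall fun x => ?_)
  simp only [eval_one]
  ring_nf

theorem gaussianIntegral_X_mul (p : ℝ[X]) :
    gaussianIntegral (X * p) = gaussianIntegral (derivative p) := by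
  have hderiv : ∀ x : ℝ, HasDerivAt (fun x : ℝ => p.eval x * Real.exp (-(x ^ 2 / 2)))
      ((derivative p - X * p).eval x * Real.exp (-(x ^ 2 / 2))) x := by
    intro x
    have hexp : HasDerivAt (fun x : ℝ => -(x ^ 2 / 2)) (-x) x :=
      ((hasDerivAt_pow 2 x).div_const 2).neg.congr_deriv (by norm_num)
    refine ((p.hasDerivAt x).mul hexp.exp).congr_deriv ?_
    rw [eval_sub, eval_mul, eval_X]
    ring
  have hzero : gaussianIntegral (derivative p - X * p) = 0 :=
    integral_eq_zero_of_hasDerivAt_of_integrable hderiv (integrable_eval_mul_gaussian _)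
      (integrable_eval_mul_gaussian p)
  rw [map_sub, sub_eq_zero] at hzero
  exact hzero.symm

theorem gaussianIntegral_realHermite_succ_mul (n : ℕ) (p : ℝ[X]) :
    gaussianIntegral (realHermite (n + 1) * p) =
      gaussianIntegral (realHermite n * derivative p) := by
  rw [realHermite_succ, sub_mul, mul_assoc, map_sub, gaussianIntegral_X_mul, derivative_mul,
    map_add, add_sub_cancel_left]

theorem gaussianIntegral_realHermite_mul (m n : ℕ) :
    gaussianIntegral (realHermite m * realHermite n) =
      if m = n then n.factorial * √(2 * Real.pi) else 0 := by
  induction m generalizing n with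
  | zero =>
    cases n with
    | zero => simp [realHermite_zero, gaussianIntegral_one]
    | succ n =>
      rw [mul_comm, gaussianIntegral_realHermite_succ_mul]
      simp [realHermite_zero]
  | succ m ih =>
    rw [gaussianIntegral_realHermite_succ_mul]
    cases n with
    | zero => simp [realHermite_zero]
    | succ n =>
      rw [derivative_realHermite_succ, mul_left_comm, gaussianIntegral_C_mul, ih]
      simp [Nat.factorial_succ, mul_assoc]

theorem gaussianIntegral_comp_affine {a b : ℝ} (hab : a ^ 2 + b ^ 2 = 1) (x : ℝ) (p : ℝ[X]) :
    gaussianIntegral ((X * p - derivative p).comp (C (a * x) + C b * X)) =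
      a * x * gaussianIntegral (p.comp (C (a * x) + C b * X)) -
        a ^ 2 * gaussianIntegral ((derivative p).comp (C (a * x) + C b * X)) := by
  have hderiv : derivative (p.comp (C (a * x) + C b * X)) =
      C b * (derivative p).comp (C (a * x) + C b * X) := by
    simp [derivative_comp]
  rw [sub_comp, mul_comp, X_comp, add_mul, mul_assoc (C b), map_sub, map_add,
    gaussianIntegral_C_mul, gaussianIntegral_C_mul, gaussianIntegral_X_mul, hderiv,
    gaussianIntegral_C_mul]
  linear_combination gaussianIntegral ((derivative p).comp (C (a * x) + C b * X)) * hab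

-- The Hermite polynomials are eigenvectors of the Ornstein-Uhlenbeck semigroup.
theorem gaussianIntegral_realHermite_comp_affine {a b : ℝ} (hab : a ^ 2 + b ^ 2 = 1) (n : ℕ)
    (x : ℝ) :
    gaussianIntegral ((realHermite n).comp (C (a * x) + C b * X)) =
      a ^ n * (realHermite n).eval x * √(2 * Real.pi) := by
  induction n using Nat.twoStepInduction with
  | zero => simp [realHermite_zero, gaussianIntegral_one]
  | one =>
    rw [realHermite_succ, gaussianIntegral_comp_affine hab]
    simp [realHermite_zero, gaussianIntegral_one]
  | more n ih ih' =>
    rw [realHermite_succ, gaussianIntegral_comp_affine hab, ih', derivative_realHermite_succ,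
      mul_comp, C_comp, gaussianIntegral_C_mul, ih, eval_sub, eval_mul, eval_mul, eval_X, eval_C]
    ring

end Hermite

section HermiteFunction

/-- The normalized Hermite functions, the eigenfunctions of the harmonic oscillator
`(q² + p²) / 2`. -/
def hermiteFun (n : ℕ) (x : ℝ) : ℝ :=
  (√(√Real.pi * n.factorial))⁻¹ * ((realHermite n).eval (√2 * x) * Real.exp (-(x ^ 2 / 2)))

theorem continuous_hermiteFun (n : ℕ) : Continuous (hermiteFun n) := by
  unfold hermiteFun
  have := (realHermite n).continuous
  fun_prop

theorem hermiteFun_zero (x : ℝ) : hermiteFun 0 x = (√√Real.pi)⁻¹ * Real.exp (-(x ^ 2 / 2)) := by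
  simp [hermiteFun, realHermite_zero]

theorem hermiteFun_mul (m n : ℕ) (x : ℝ) : hermiteFun m x * hermiteFun n x =
    ((√(√Real.pi * m.factorial))⁻¹ * (√(√Real.pi * n.factorial))⁻¹) *
      ((realHermite m * realHermite n).eval (√2 * x) * Real.exp (-((√2 * x) ^ 2 / 2))) := by
  have hexp :
      Real.exp (-((√2 * x) ^ 2 / 2)) = Real.exp (-(x ^ 2 / 2)) * Real.exp (-(x ^ 2 / 2)) := by
    rw [← Real.exp_add, mul_pow, Real.sq_sqrt zero_le_two]
    ring_nf
  rw [hexp, hermiteFun, hermiteFun, Polynomial.eval_mul]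
  ring

theorem integrable_hermiteFun_mul (m n : ℕ) :
    Integrable fun x => hermiteFun m x * hermiteFun n x := by
  simp_rw [hermiteFun_mul]
  exact ((integrable_eval_mul_gaussian (realHermite m * realHermite n)).comp_mul_left'
    (by positivity : (√2 : ℝ) ≠ 0)).const_mul _

theorem integral_hermiteFun_mul (m n : ℕ) :
    ∫ x, hermiteFun m x * hermiteFun n x = if m = n then 1 else 0 := by
  simp_rw [hermiteFun_mul]
  rw [integral_const_mul, Measure.integral_comp_mul_left
    (fun y => (realHermite m * realHermite n).eval y * Real.exp (-(y ^ 2 / 2))),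
    ← gaussianIntegral_apply, gaussianIntegral_realHermite_mul]
  split_ifs with hmn
  · subst hmn
    have _ : 0 < √Real.pi := Real.sqrt_pos.2 Real.pi_pos
    rw [← mul_inv, Real.mul_self_sqrt (by positivity), abs_of_pos (by positivity), smul_eq_mul,
      Real.sqrt_mul zero_le_two]
    field_simp
  · simp

/-- The wave function of the two-mode squeezed vacuum. -/
def squeezedFun (r x y : ℝ) : ℝ :=
  hermiteFun 0 (Real.cosh r * x - Real.sinh r * y) *
    hermiteFun 0 (Real.cosh r * y - Real.sinh r * x)

-- Completing the square in `x`: the Gaussian factors into one in `y` and one in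
-- `z = √2 (cosh r x - sinh r y)`.
theorem hermiteFun_mul_squeezedFun (r : ℝ) (n : ℕ) (x y : ℝ) :
    hermiteFun n x * squeezedFun r x y =
      ((√(√Real.pi * n.factorial))⁻¹ * (√Real.pi)⁻¹ * Real.exp (-(y ^ 2 / 2))) *
        (((realHermite n).comp (.C (Real.tanh r * (√2 * y)) + .C (Real.cosh r)⁻¹ * .X)).eval
            (√2 * Real.cosh r * (x - Real.tanh r * y)) *
          Real.exp (-((√2 * Real.cosh r * (x - Real.tanh r * y)) ^ 2 / 2))) := by
  have hc : Real.cosh r ≠ 0 := (Real.cosh_pos r).ne'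
  have harg : Real.tanh r * (√2 * y) +
      (Real.cosh r)⁻¹ * (√2 * Real.cosh r * (x - Real.tanh r * y)) = √2 * x := by
    field_simp
    ring
  have hexp : Real.exp (-(x ^ 2 / 2)) *
      (Real.exp (-((Real.cosh r * x - Real.sinh r * y) ^ 2 / 2)) *
        Real.exp (-((Real.cosh r * y - Real.sinh r * x) ^ 2 / 2))) =
      Real.exp (-(y ^ 2 / 2)) *
        Real.exp (-((√2 * Real.cosh r * (x - Real.tanh r * y)) ^ 2 / 2)) := by
    have hz : √2 * Real.cosh r * (x - Real.tanh r * y) =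
        √2 * (Real.cosh r * x - Real.sinh r * y) := by
      rw [Real.tanh_eq_sinh_div_cosh]
      field_simp
    rw [hz, mul_pow, Real.sq_sqrt zero_le_two, ← Real.exp_add, ← Real.exp_add, ← Real.exp_add]
    congr 1
    linear_combination (x ^ 2 / 2 - y ^ 2 / 2) * Real.cosh_sq_sub_sinh_sq r
  have hπ : (√√Real.pi)⁻¹ * (√√Real.pi)⁻¹ = (√Real.pi)⁻¹ := by
    rw [← mul_inv, Real.mul_self_sqrt (by positivity)]
  simp only [Polynomial.eval_comp, Polynomial.eval_add, Polynomial.eval_mul, Polynomial.eval_C,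
    Polynomial.eval_X, harg]
  rw [squeezedFun, hermiteFun_zero, hermiteFun_zero, hermiteFun, ← hπ]
  linear_combination ((√(√Real.pi * n.factorial))⁻¹ * ((√√Real.pi)⁻¹ * (√√Real.pi)⁻¹) *
    (realHermite n).eval (√2 * x)) * hexp

theorem integral_hermiteFun_mul_squeezedFun (r : ℝ) (n : ℕ) (y : ℝ) :
    ∫ x, hermiteFun n x * squeezedFun r x y =
      Real.tanh r ^ n / Real.cosh r * hermiteFun n y := by
  set q := (realHermite n).comp (.C (Real.tanh r * (√2 * y)) + .C (Real.cosh r)⁻¹ * .X)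
  have hτ : Real.tanh r ^ 2 + (Real.cosh r)⁻¹ ^ 2 = 1 := by
    rw [Real.tanh_eq_sinh_div_cosh]
    field_simp
    linarith [Real.cosh_sq r]
  have _ : 0 < Real.cosh r := Real.cosh_pos r
  have hscale : ∫ x, q.eval (√2 * Real.cosh r * (x - Real.tanh r * y)) *
      Real.exp (-((√2 * Real.cosh r * (x - Real.tanh r * y)) ^ 2 / 2)) =
        (√2 * Real.cosh r)⁻¹ * gaussianIntegral q := by
    rw [integral_sub_right_eq_self (fun x => q.eval (√2 * Real.cosh r * x) *
        Real.exp (-((√2 * Real.cosh r * x) ^ 2 / 2))),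
      Measure.integral_comp_mul_left (fun z => q.eval z * Real.exp (-(z ^ 2 / 2))),
      abs_of_pos (by positivity), smul_eq_mul, gaussianIntegral_apply]
  have _ : 0 < √Real.pi := Real.sqrt_pos.2 Real.pi_pos
  simp_rw [hermiteFun_mul_squeezedFun]
  rw [integral_const_mul, hscale, gaussianIntegral_realHermite_comp_affine hτ, hermiteFun,
    Real.sqrt_mul zero_le_two]
  field_simp

end HermiteFunction

section NumberState

variable {ι : Type} [Fintype ι]

/-- The wave function of a number state: a product of Hermite functions. -/
def numFun (K : ι → ℕ) (x : ι → ℝ) : ℝ := ∏ i, hermiteFun (K i) (x i)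

theorem continuous_numFun (K : ι → ℕ) : Continuous (numFun K) :=
  continuous_finsetProd _ fun i _ => (continuous_hermiteFun (K i)).comp (continuous_apply i)

theorem numFun_mul (K L : ι → ℕ) (x : ι → ℝ) :
    numFun K x * numFun L x = ∏ i, hermiteFun (K i) (x i) * hermiteFun (L i) (x i) :=
  Finset.prod_mul_distrib.symm

theorem integrable_numFun_mul (K L : ι → ℕ) :
    Integrable fun x : ι → ℝ => numFun K x * numFun L x := by
  simp_rw [numFun_mul]
  exact Integrable.fintype_prod (f := fun i y => hermiteFun (K i) y * hermiteFun (L i) y)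
    fun i => integrable_hermiteFun_mul (K i) (L i)

theorem integral_numFun_mul (K L : ι → ℕ) :
    ∫ x : ι → ℝ, numFun K x * numFun L x = if K = L then 1 else 0 := by
  simp_rw [numFun_mul]
  rw [integral_fintype_prod_volume_eq_prod (fun i y => hermiteFun (K i) y * hermiteFun (L i) y)]
  simp_rw [integral_hermiteFun_mul, Fintype.prod_boole, funext_iff]

theorem memLp_numFun (K : ι → ℕ) :
    MemLp (fun x : ι → ℝ => (numFun K x : ℂ)) 2 (volume : Measure (ι → ℝ)) := by
  have hmeas : AEStronglyMeasurable (fun x : ι → ℝ => (numFun K x : ℂ)) volume :=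
    (Complex.continuous_ofReal.comp (continuous_numFun K)).aestronglyMeasurable
  rw [memLp_two_iff_integrable_sq_norm hmeas]
  refine (integrable_numFun_mul K K).congr (Filter.Eventually.of_forall fun x => ?_)
  simp [sq]

/-- The number state with occupation numbers `K`; `K = 0` is the vacuum. -/
def numState (K : ι → ℕ) : ModeSpace ι := (memLp_numFun K).toLp _

theorem coeFn_numState (K : ι → ℕ) :
    (numState K : (ι → ℝ) → ℂ) =ᵐ[volume] fun x => (numFun K x : ℂ) :=
  MemLp.coeFn_toLp _

theorem orthonormal_numState : Orthonormal ℂ (numState : (ι → ℕ) → ModeSpace ι) := by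
  classical
  rw [orthonormal_iff_ite]
  intro K L
  have hinner : ∀ᵐ x, inner ℂ (numState K x) (numState L x) =
      ((numFun K x * numFun L x : ℝ) : ℂ) := by
    filter_upwards [coeFn_numState K, coeFn_numState L] with x hK hL
    rw [hK, hL]
    simp [mul_comm]
  rw [L2.inner_def, integral_congr_ae hinner, integral_complex_ofReal, integral_numFun_mul]
  split_ifs <;> simp

theorem hermiteFun_zero_weyl (u v x : ℝ) :
    Complex.exp (Complex.I * ((u * x + u * v / 2 : ℝ) : ℂ)) * (hermiteFun 0 (x + v) : ℂ) *
      (hermiteFun 0 x : ℂ) = (((√Real.pi)⁻¹ : ℝ) : ℂ) *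
        Complex.exp ((-1 : ℂ) * (x : ℂ) ^ 2 + (-(v : ℂ) + Complex.I * u) * x +
          (-(v : ℂ) ^ 2 / 2 + Complex.I * u * v / 2)) := by
  have hπ : (√√Real.pi)⁻¹ * (√√Real.pi)⁻¹ = (√Real.pi)⁻¹ := by
    rw [← mul_inv, Real.mul_self_sqrt (by positivity)]
  have hexp : Complex.exp ((-1 : ℂ) * (x : ℂ) ^ 2 + (-(v : ℂ) + Complex.I * u) * x +
      (-(v : ℂ) ^ 2 / 2 + Complex.I * u * v / 2)) =
      Complex.exp (Complex.I * (u * x + u * v / 2)) * Complex.exp (-((x + v : ℂ) ^ 2 / 2)) *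
        Complex.exp (-((x : ℂ) ^ 2 / 2)) := by
    rw [← Complex.exp_add, ← Complex.exp_add]
    congr 1
    ring
  rw [hermiteFun_zero, hermiteFun_zero, ← hπ, hexp]
  push_cast
  ring

theorem integral_hermiteFun_zero_weyl (u v : ℝ) :
    ∫ x : ℝ, Complex.exp (Complex.I * ((u * x + u * v / 2 : ℝ) : ℂ)) * (hermiteFun 0 (x + v) : ℂ) *
      (hermiteFun 0 x : ℂ) = Complex.exp ((-(u ^ 2 + v ^ 2) / 4 : ℝ) : ℂ) := by
  have hsqrt : ((Real.pi : ℂ) / -(-1 : ℂ)) ^ (1 / 2 : ℂ) = ((√Real.pi : ℝ) : ℂ) := by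
    rw [Real.sqrt_eq_rpow, Complex.ofReal_cpow Real.pi_pos.le]
    norm_num
  simp_rw [hermiteFun_zero_weyl]
  rw [integral_const_mul, integral_cexp_quadratic (by simp), hsqrt, ← mul_assoc,
    ← Complex.ofReal_mul, inv_mul_cancel₀ (Real.sqrt_pos.2 Real.pi_pos).ne', Complex.ofReal_one,
    one_mul]
  congr 1
  push_cast
  linear_combination ((u : ℂ) ^ 2 / 4) * Complex.I_sq

theorem inner_numState_zero_weyl (c : ι ⊕ ι → ℝ) :
    inner ℂ (numState (0 : ι → ℕ)) (weyl c (numState 0)) =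
      Complex.exp ((-(c ⬝ᵥ c) / 4 : ℝ) : ℂ) := by
  set f : ι → ℝ → ℂ := fun i y =>
    Complex.exp (Complex.I * ((c (Sum.inl i) * y + c (Sum.inl i) * c (Sum.inr i) / 2 : ℝ) : ℂ)) *
      (hermiteFun 0 (y + c (Sum.inr i)) : ℂ) * (hermiteFun 0 y : ℂ)
  have hinner : ∀ᵐ x : ι → ℝ, inner ℂ (numState (0 : ι → ℕ) x) (weyl c (numState 0) x) =
      ∏ i, f i (x i) := by
    filter_upwards [coeFn_weyl c (numState 0), coeFn_numState (0 : ι → ℕ),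
      (quasiMeasurePreserving_add_right volume (c ∘ Sum.inr)).ae (coeFn_numState (0 : ι → ℕ))]
      with x hweyl hnum hshift
    rw [hweyl, hnum, weylFun, hshift, Finset.prod_mul_distrib, Finset.prod_mul_distrib,
      ← Complex.exp_sum, ← Finset.mul_sum, ← Complex.ofReal_sum, Finset.sum_add_distrib,
      ← Finset.sum_div]
    simp [numFun]
  rw [L2.inner_def, integral_congr_ae hinner, integral_fintype_prod_volume_eq_prod f]
  simp_rw [f, integral_hermiteFun_zero_weyl]
  rw [← Complex.exp_sum, ← Complex.ofReal_sum, ← Finset.sum_div, Finset.sum_neg_distrib,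
    Finset.sum_add_distrib, dotProduct, Fintype.sum_sum_type]
  simp only [sq]

theorem isPureGaussian_numState_zero : IsPureGaussian (numState (0 : ι → ℕ)) := by
  classical
  exact ⟨1, Matrix.isSymm_one, fun c => by rw [Matrix.one_mulVec, inner_numState_zero_weyl]⟩

theorem IsPureGaussian.pullback [DecidableEq ι] {ψ : ModeSpace ι} (hψ : IsPureGaussian ψ)
    {M : Matrix ι ι ℝ} (hM : |M.det| = 1) : IsPureGaussian (pullback M hM ψ) := by
  obtain ⟨V, hV, hchar⟩ := hψ
  set T : Matrix (ι ⊕ ι) (ι ⊕ ι) ℝ := Matrix.fromBlocks M⁻¹ᵀ 0 0 M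
  refine ⟨Tᵀ * V * T, ?_, fun c => ?_⟩
  · rw [Matrix.IsSymm, Matrix.transpose_mul, Matrix.transpose_mul, Matrix.transpose_transpose,
      hV.eq, Matrix.mul_assoc]
  have hT : Sum.elim (M⁻¹ᵀ *ᵥ (c ∘ Sum.inl)) (M *ᵥ (c ∘ Sum.inr)) = T *ᵥ c := by
    simp [T, Matrix.fromBlocks_mulVec]
  rw [weyl_pullback, LinearIsometryEquiv.inner_map_map, hT, hchar, ← Matrix.mulVec_mulVec,
    ← Matrix.mulVec_mulVec, Matrix.dotProduct_mulVec c, Matrix.vecMul_transpose]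

end NumberState

section Squeezing

theorem extend_neg_zero {ι κ : Type*} (e : ι → κ) (r : ι → ℝ) :
    Function.extend e (-r) 0 = -(Function.extend e r 0 : κ → ℝ) := by
  rw [← Function.extend_neg, neg_zero]

variable {ι κ : Type} [DecidableEq ι] [DecidableEq κ] {e : ι → κ}

/-- The action on positions of two-mode squeezing of the mode pairs `(i, e i)` with parameters
`r i`. The modes outside the range of `e` are not affected. -/
def squeezeMatrix (e : ι → κ) (r : ι → ℝ) : Matrix (ι ⊕ κ) (ι ⊕ κ) ℝ :=
  Matrix.fromBlocks (Matrix.diagonal fun i => Real.cosh (r i))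
    (Matrix.of fun i j => if e i = j then -Real.sinh (r i) else 0)
    (Matrix.of fun j i => if e i = j then -Real.sinh (r i) else 0)
    (Matrix.diagonal fun j => Real.cosh (Function.extend e r 0 j))

theorem transpose_squeezeMatrix (e : ι → κ) (r : ι → ℝ) :
    (squeezeMatrix e r)ᵀ = squeezeMatrix e r := by
  simp only [squeezeMatrix, Matrix.fromBlocks_transpose, Matrix.diagonal_transpose]
  rfl

variable [Fintype ι] [Fintype κ]

theorem squeezeMatrix_mulVec_inl (e : ι → κ) (r : ι → ℝ) (z : ι ⊕ κ → ℝ) (i : ι) :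
    (squeezeMatrix e r *ᵥ z) (Sum.inl i) =
      Real.cosh (r i) * z (Sum.inl i) - Real.sinh (r i) * z (Sum.inr (e i)) := by
  rw [squeezeMatrix, Matrix.fromBlocks_mulVec, Sum.elim_inl, Pi.add_apply, Matrix.mulVec_diagonal]
  simp [Matrix.mulVec, dotProduct, sub_eq_add_neg]

theorem squeezeMatrix_mulVec_inr_apply (he : Function.Injective e) (r : ι → ℝ) (z : ι ⊕ κ → ℝ)
    (i : ι) :
    (squeezeMatrix e r *ᵥ z) (Sum.inr (e i)) =
      Real.cosh (r i) * z (Sum.inr (e i)) - Real.sinh (r i) * z (Sum.inl i) := by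
  rw [squeezeMatrix, Matrix.fromBlocks_mulVec, Sum.elim_inr, Pi.add_apply, Matrix.mulVec_diagonal,
    he.extend_apply]
  simp only [Matrix.mulVec, dotProduct, Matrix.of_apply, he.eq_iff, ite_mul, zero_mul,
    Finset.sum_ite_eq', Finset.mem_univ, if_true, Function.comp_apply]
  ring

theorem squeezeMatrix_mulVec_inr_of_notMem (r : ι → ℝ) (z : ι ⊕ κ → ℝ) {j : κ}
    (hj : j ∉ Set.range e) : (squeezeMatrix e r *ᵥ z) (Sum.inr j) = z (Sum.inr j) := by
  have hne : ∀ i, e i ≠ j := fun i hi => hj ⟨i, hi⟩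
  rw [squeezeMatrix, Matrix.fromBlocks_mulVec, Sum.elim_inr, Pi.add_apply, Matrix.mulVec_diagonal,
    Function.extend_apply' _ _ _ hj]
  simp [Matrix.mulVec, dotProduct, hne]

theorem squeezeMatrix_mul_neg (he : Function.Injective e) (r : ι → ℝ) :
    squeezeMatrix e r * squeezeMatrix e (-r) = 1 := by
  refine Matrix.toLin'.injective (LinearMap.ext fun z => funext fun k => ?_)
  rw [Matrix.toLin'_apply, Matrix.toLin'_apply, Matrix.one_mulVec, ← Matrix.mulVec_mulVec]
  rcases k with i | j
  · rw [squeezeMatrix_mulVec_inl, squeezeMatrix_mulVec_inl, squeezeMatrix_mulVec_inr_apply he,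
      Pi.neg_apply, Real.cosh_neg, Real.sinh_neg]
    linear_combination z (Sum.inl i) * Real.cosh_sq_sub_sinh_sq (r i)
  · by_cases hj : j ∈ Set.range e
    · obtain ⟨i, rfl⟩ := hj
      rw [squeezeMatrix_mulVec_inr_apply he, squeezeMatrix_mulVec_inl,
        squeezeMatrix_mulVec_inr_apply he, Pi.neg_apply, Real.cosh_neg, Real.sinh_neg]
      linear_combination z (Sum.inr (e i)) * Real.cosh_sq_sub_sinh_sq (r i)
    · rw [squeezeMatrix_mulVec_inr_of_notMem _ _ hj, squeezeMatrix_mulVec_inr_of_notMem _ _ hj]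

theorem squeezeMatrix_neg (e : ι → κ) (r : ι → ℝ) :
    squeezeMatrix e (-r) =
      Matrix.fromBlocks 1 0 0 (-1) * squeezeMatrix e r * Matrix.fromBlocks 1 0 0 (-1) := by
  simp only [squeezeMatrix, Matrix.fromBlocks_multiply, extend_neg_zero]
  congr 1 <;> ext i j <;> simp [apply_ite (fun x : ℝ => -x)]

theorem abs_det_squeezeMatrix (he : Function.Injective e) (r : ι → ℝ) :
    |(squeezeMatrix e r).det| = 1 := by
  set D : Matrix (ι ⊕ κ) (ι ⊕ κ) ℝ := Matrix.fromBlocks 1 0 0 (-1)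
  have hD : D.det * D.det = 1 := by
    simp [← Matrix.det_mul, D]
  have hinv : (squeezeMatrix e r).det * (squeezeMatrix e (-r)).det = 1 := by
    rw [← Matrix.det_mul, squeezeMatrix_mul_neg he, Matrix.det_one]
  rw [squeezeMatrix_neg, Matrix.det_mul, Matrix.det_mul] at hinv
  rw [abs_eq zero_le_one, ← sq_eq_one_iff]
  linear_combination hinv - (squeezeMatrix e r).det ^ 2 * hD

/-- The two-mode squeezed vacuum: the vacuum after two-mode squeezing of the pairs `(i, e i)` with
parameters `r i`. -/
def squeezedState (he : Function.Injective e) (r : ι → ℝ) : ModeSpace (ι ⊕ κ) :=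
  pullback (squeezeMatrix e r) (abs_det_squeezeMatrix he r) (numState 0)

theorem norm_squeezedState (he : Function.Injective e) (r : ι → ℝ) : ‖squeezedState he r‖ = 1 := by
  rw [squeezedState, LinearIsometryEquiv.norm_map, orthonormal_numState.norm_eq_one]

theorem isPureGaussian_squeezedState (he : Function.Injective e) (r : ι → ℝ) :
    IsPureGaussian (squeezedState he r) :=
  isPureGaussian_numState_zero.pullback _

theorem inner_squeezedState_weyl (he : Function.Injective e) (r : ι → ℝ)
    (c : (ι ⊕ κ) ⊕ (ι ⊕ κ) → ℝ) :
    inner ℂ (squeezedState he r) (weyl c (squeezedState he r)) =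
      Complex.exp ((-(∑ k, (squeezeMatrix e (-r) *ᵥ (c ∘ Sum.inl)) k ^ 2 +
        ∑ k, (squeezeMatrix e r *ᵥ (c ∘ Sum.inr)) k ^ 2) / 4 : ℝ) : ℂ) := by
  rw [squeezedState, weyl_pullback, LinearIsometryEquiv.inner_map_map, inner_numState_zero_weyl,
    Matrix.inv_eq_right_inv (squeezeMatrix_mul_neg he r), transpose_squeezeMatrix, dotProduct,
    Fintype.sum_sum_type]
  simp only [Sum.elim_inl, Sum.elim_inr, sq]

theorem coeFn_squeezedState (he : Function.Injective e) (r : ι → ℝ) :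
    (squeezedState he r : (ι ⊕ κ → ℝ) → ℂ) =ᵐ[volume] fun z =>
      (numFun 0 (squeezeMatrix e r *ᵥ z) : ℂ) :=
  (coeFn_pullback (abs_det_squeezeMatrix he r) (numState 0)).trans <|
    (measurePreserving_mulVec (abs_det_squeezeMatrix he r)).quasiMeasurePreserving.ae
      (coeFn_numState 0)

end Squeezing

section ProductDistribution

variable {ι α : Type*}

theorem hasSum_mul_prod {β : Type*} {f : α → ℝ} {g : β → ℝ} {a b : ℝ} (hf : HasSum f a)
    (hg : HasSum g b) : HasSum (fun x : α × β => f x.1 * g x.2) (a * b) := by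
  have hf' : Summable fun x => ‖f x‖ := summable_norm_iff.2 hf.summable
  have hg' : Summable fun x => ‖g x‖ := summable_norm_iff.2 hg.summable
  exact hf.mul hg (summable_mul_of_summable_norm hf' hg')

theorem hasSum_fin_pi_prod {n : ℕ} {f : Fin n → α → ℝ} {a : Fin n → ℝ}
    (hf : ∀ i, HasSum (f i) (a i)) :
    HasSum (fun K : Fin n → α => ∏ i, f i (K i)) (∏ i, a i) := by
  induction n with
  | zero => simp
  | succ n ih =>
    rw [← (Fin.consEquiv fun _ => α).hasSum_iff, Fin.prod_univ_succ]
    simpa only [Function.comp_def, Fin.consEquiv_apply, Fin.prod_univ_succ, Fin.cons_zero,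
      Fin.cons_succ] using hasSum_mul_prod (hf 0) (ih fun i => hf i.succ)

theorem hasSum_pi_prod [Fintype ι] {f : ι → α → ℝ} {a : ι → ℝ} (hf : ∀ i, HasSum (f i) (a i)) :
    HasSum (fun K : ι → α => ∏ i, f i (K i)) (∏ i, a i) := by
  have e := (Fintype.equivFin ι).symm
  rw [← (e.arrowCongr (Equiv.refl α)).hasSum_iff, ← e.prod_comp]
  convert hasSum_fin_pi_prod fun k => hf (e k) using 2 with K
  simp [← e.prod_comp]

theorem negMulLog_prod [DecidableEq ι] (p : ι → ℝ) (s : Finset ι) :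
    Real.negMulLog (∏ i ∈ s, p i) =
      ∑ i ∈ s, Real.negMulLog (p i) * ∏ j ∈ s.erase i, p j := by
  induction s using Finset.induction_on with
  | empty => simp
  | insert k s hk ih =>
    rw [Finset.prod_insert hk, Real.negMulLog_mul, ih, Finset.sum_insert hk,
      Finset.erase_insert hk, Finset.mul_sum, mul_comm]
    refine congrArg (_ + ·) (Finset.sum_congr rfl fun i hi => ?_)
    have hki : k ≠ i := fun h => hk (h ▸ hi)
    rw [Finset.erase_insert_of_ne hki, Finset.prod_insert fun h => hk (Finset.mem_of_mem_erase h)]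
    ring

theorem hasSum_negMulLog_prod [Fintype ι] {p : ι → α → ℝ} {h : ι → ℝ} (hp : ∀ i, HasSum (p i) 1)
    (hh : ∀ i, HasSum (fun n => Real.negMulLog (p i n)) (h i)) :
    HasSum (fun K : ι → α => Real.negMulLog (∏ i, p i (K i))) (∑ i, h i) := by
  classical
  have hterm : ∀ i, HasSum (fun K : ι → α => Real.negMulLog (p i (K i)) *
      ∏ j ∈ Finset.univ.erase i, p j (K j)) (h i) := by
    intro i
    have hprod := hasSum_pi_prod (a := Function.update 1 i (h i))
      (f := Function.update p i fun n => Real.negMulLog (p i n)) fun j => by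
        rcases eq_or_ne j i with rfl | hji
        · simpa using hh j
        · simpa [hji] using hp j
    convert hprod using 1
    · funext K
      rw [← Finset.mul_prod_erase _ _ (Finset.mem_univ i), Function.update_self]
      refine congrArg (_ * ·) (Finset.prod_congr rfl fun j hj => ?_)
      rw [Function.update_of_ne (Finset.ne_of_mem_erase hj)]
    · simp [Finset.prod_update_of_mem]
  simpa only [negMulLog_prod] using hasSum_sum fun i _ => hterm i

end ProductDistribution

section ThermalEntropy

/-- The entropy of a thermal state of one mode with mean occupation number `n`. -/
def thermalEntropy (n : ℝ) : ℝ := (n + 1) * Real.log (n + 1) - n * Real.log n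

theorem continuous_thermalEntropy : Continuous thermalEntropy := by
  have hsub : thermalEntropy = fun n => Real.negMulLog n - Real.negMulLog (n + 1) := by
    funext n
    simp only [thermalEntropy, Real.negMulLog]
    ring
  rw [hsub]
  exact Real.continuous_negMulLog.sub (Real.continuous_negMulLog.comp (continuous_add_const 1))

theorem thermalEntropy_zero : thermalEntropy 0 = 0 := by simp [thermalEntropy]

theorem thermalEntropy_eq_log_add {n : ℝ} (hn : 0 < n) :
    thermalEntropy n = Real.log (n + 1) + n * Real.log (1 + 1 / n) := by
  rw [one_add_div hn.ne', Real.log_div (by positivity) hn.ne', thermalEntropy]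
  ring

theorem thermalEntropy_one : thermalEntropy 1 = 2 * Real.log 2 := by
  norm_num [thermalEntropy]

theorem log_add_one_le_thermalEntropy {n : ℝ} (hn : 0 < n) :
    Real.log (n + 1) ≤ thermalEntropy n := by
  rw [thermalEntropy_eq_log_add hn]
  exact le_add_of_nonneg_right
    (mul_nonneg hn.le (Real.log_nonneg (le_add_of_nonneg_right (by positivity))))

theorem thermalEntropy_lt_mul_thermalEntropy_one {m : ℕ} (hm : 2 ≤ m) :
    thermalEntropy m < m * thermalEntropy 1 := by
  have hm' : (2 : ℝ) ≤ m := by exact_mod_cast hm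
  have hbernoulli : Real.log (m + 1) ≤ m * Real.log 2 := by
    rw [← Real.log_pow]
    exact Real.log_le_log (by positivity) (by exact_mod_cast Nat.lt_two_pow_self)
  have hlog : Real.log (1 + 1 / m) < Real.log 2 := by
    refine Real.log_lt_log (by positivity) ?_
    have : 1 / (m : ℝ) < 1 := (div_lt_one (by positivity)).2 (by linarith)
    linarith
  rw [thermalEntropy_eq_log_add (by positivity), thermalEntropy_one]
  nlinarith

theorem exists_thermalEntropy_eq_mul {m : ℕ} (hm : 2 ≤ m) :
    ∃ b : ℝ, m < b ∧ thermalEntropy b = m * thermalEntropy 1 := by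
  have hlt : (m : ℝ) < 4 ^ m := by exact_mod_cast m.lt_pow_self (by norm_num)
  have hlarge : m * thermalEntropy 1 ≤ thermalEntropy (4 ^ m) := by
    refine le_trans ?_ (log_add_one_le_thermalEntropy (by positivity))
    refine le_trans ?_ (Real.log_le_log (by positivity) (lt_add_one ((4 : ℝ) ^ m)).le)
    rw [Real.log_pow, thermalEntropy_one, show (4 : ℝ) = 2 ^ 2 by norm_num, Real.log_pow]
    norm_num
  obtain ⟨b, hb, hbm⟩ := intermediate_value_Icc hlt.le continuous_thermalEntropy.continuousOn
    ⟨(thermalEntropy_lt_mul_thermalEntropy_one hm).le, hlarge⟩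
  refine ⟨b, lt_of_le_of_ne hb.1 ?_, hbm⟩
  rintro rfl
  exact (thermalEntropy_lt_mul_thermalEntropy_one hm).ne hbm

theorem hasSum_geometric_mul {l : ℝ} (hl₀ : 0 ≤ l) (hl₁ : l < 1) :
    HasSum (fun k : ℕ => l ^ k * (1 - l)) 1 := by
  simpa only [inv_mul_cancel₀ (sub_pos.2 hl₁).ne'] using
    (hasSum_geometric_of_lt_one hl₀ hl₁).mul_right (1 - l)

theorem hasSum_negMulLog_geometric {l : ℝ} (hl₀ : 0 ≤ l) (hl₁ : l < 1) :
    HasSum (fun k : ℕ => Real.negMulLog (l ^ k * (1 - l))) (thermalEntropy (l / (1 - l))) := by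
  have hsub : 0 < 1 - l := sub_pos.2 hl₁
  rcases hl₀.eq_or_lt with rfl | hl₀'
  · convert hasSum_single 0 fun k hk => ?_ using 1
    · simp [thermalEntropy]
    · simp [hk]
  have hterm : ∀ k : ℕ, Real.negMulLog (l ^ k * (1 - l)) =
      -Real.log (1 - l) * (l ^ k * (1 - l)) + -(Real.log l * (1 - l)) * (k * l ^ k) := by
    intro k
    rw [Real.negMulLog, Real.log_mul (pow_pos hl₀' k).ne' hsub.ne', Real.log_pow]
    ring
  have hmean := hasSum_coe_mul_geometric_of_norm_lt_one (r := l)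
    (by rwa [Real.norm_eq_abs, abs_of_pos hl₀'])
  simp_rw [hterm]
  have hsucc : l / (1 - l) + 1 = 1 / (1 - l) := by rw [div_add_one hsub.ne', add_sub_cancel]
  have hvalue : thermalEntropy (l / (1 - l)) =
      -Real.log (1 - l) * 1 + -(Real.log l * (1 - l)) * (l / (1 - l) ^ 2) := by
    rw [thermalEntropy, hsucc, Real.log_div hl₀'.ne' hsub.ne', one_div, Real.log_inv]
    field_simp
    ring
  rw [hvalue]
  exact ((hasSum_geometric_mul hl₀ hl₁).mul_left _).add (hmean.mul_left _)

end ThermalEntropy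

section SchmidtCoefficients

/-- The Schmidt coefficient of `|n⟩ ⊗ |n⟩` in the two-mode squeezed vacuum with parameter `r`. -/
def schmidtCoeff (r : ℝ) (n : ℕ) : ℝ := Real.tanh r ^ n / Real.cosh r

theorem one_sub_tanh_sq (r : ℝ) : 1 - Real.tanh r ^ 2 = (Real.cosh r ^ 2)⁻¹ := by
  have hcosh := (Real.cosh_pos r).ne'
  rw [Real.tanh_eq_sinh_div_cosh, div_pow, one_sub_div (pow_ne_zero 2 hcosh),
    Real.cosh_sq_sub_sinh_sq, one_div]

theorem schmidtCoeff_sq (r : ℝ) (n : ℕ) :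
    schmidtCoeff r n ^ 2 = (Real.tanh r ^ 2) ^ n * (1 - Real.tanh r ^ 2) := by
  rw [one_sub_tanh_sq, schmidtCoeff, div_pow, pow_right_comm, div_eq_mul_inv]

theorem tanh_sq_div_one_sub_tanh_sq (r : ℝ) :
    Real.tanh r ^ 2 / (1 - Real.tanh r ^ 2) = Real.sinh r ^ 2 := by
  rw [one_sub_tanh_sq, div_inv_eq_mul, ← mul_pow, Real.tanh_eq_sinh_div_cosh,
    div_mul_cancel₀ _ (Real.cosh_pos r).ne']

theorem hasSum_schmidtCoeff_sq (r : ℝ) : HasSum (fun n => schmidtCoeff r n ^ 2) 1 := by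
  simp_rw [schmidtCoeff_sq]
  exact hasSum_geometric_mul (sq_nonneg _) (Real.tanh_sq_lt_one r)

theorem hasSum_negMulLog_schmidtCoeff_sq (r : ℝ) :
    HasSum (fun n => Real.negMulLog (schmidtCoeff r n ^ 2)) (thermalEntropy (Real.sinh r ^ 2)) := by
  simp_rw [schmidtCoeff_sq, ← tanh_sq_div_one_sub_tanh_sq]
  exact hasSum_negMulLog_geometric (sq_nonneg _) (Real.tanh_sq_lt_one r)

end SchmidtCoefficients

section SchmidtDecomposition

theorem norm_sub_sum_inner_smul_sq {G α : Type*} [NormedAddCommGroup G] [InnerProductSpace ℂ G]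
    {g : α → G} (hg : Orthonormal ℂ g) (ψ : G) (s : Finset α) :
    ‖ψ - ∑ n ∈ s, inner ℂ (g n) ψ • g n‖ ^ 2 = ‖ψ‖ ^ 2 - ∑ n ∈ s, ‖inner ℂ (g n) ψ‖ ^ 2 := by
  set φ : G := ∑ n ∈ s, inner ℂ (g n) ψ • g n with hφ
  have hself : inner ℂ φ φ = ((∑ n ∈ s, ‖inner ℂ (g n) ψ‖ ^ 2 : ℝ) : ℂ) := by
    rw [hφ, hg.inner_sum]
    push_cast
    exact Finset.sum_congr rfl fun n _ => RCLike.conj_mul _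
  have hψ : inner ℂ φ ψ = inner ℂ φ φ := by
    rw [hφ, hg.inner_sum, sum_inner]
    exact Finset.sum_congr rfl fun n _ => inner_smul_left _ _ _
  have hnorm : ‖φ‖ ^ 2 = ∑ n ∈ s, ‖inner ℂ (g n) ψ‖ ^ 2 := by
    rw [@norm_sq_eq_re_inner ℂ, hself, RCLike.re_to_complex, Complex.ofReal_re]
  rw [norm_sub_rev, @norm_sub_sq ℂ, hψ, hself, hnorm, RCLike.re_to_complex, Complex.ofReal_re]
  ring

theorem hasSum_inner_smul {G α : Type*} [NormedAddCommGroup G] [InnerProductSpace ℂ G]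
    {g : α → G} (hg : Orthonormal ℂ g) {ψ : G}
    (hsum : HasSum (fun n => ‖inner ℂ (g n) ψ‖ ^ 2) (‖ψ‖ ^ 2)) :
    HasSum (fun n => inner ℂ (g n) ψ • g n) ψ := by
  rw [HasSum, tendsto_iff_norm_sub_tendsto_zero]
  have hsq := (tendsto_const_nhds (x := ‖ψ‖ ^ 2)).sub hsum
  rw [sub_self] at hsq
  have hnorm := hsq.sqrt
  rw [Real.sqrt_zero] at hnorm
  refine hnorm.congr fun s => ?_
  rw [← norm_sub_sum_inner_smul_sq hg, Real.sqrt_sq (norm_nonneg _), norm_sub_rev]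

theorem IsTensorIsometry.orthonormal {E F G α : Type*} [NormedAddCommGroup E]
    [InnerProductSpace ℂ E] [NormedAddCommGroup F] [InnerProductSpace ℂ F] [NormedAddCommGroup G]
    [InnerProductSpace ℂ G] {B : E →L[ℂ] F →L[ℂ] G} (hB : IsTensorIsometry B) {f : α → E}
    {g : α → F} (hf : Orthonormal ℂ f) (hg : Orthonormal ℂ g) :
    Orthonormal ℂ fun n => B (f n) (g n) := by
  classical
  rw [orthonormal_iff_ite] at hf hg ⊢
  intro n m
  rw [hB, hf, hg, mul_boole]
  split_ifs <;> rfl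

theorem hasSum_prod_schmidtCoeff_sq {ι : Type*} [Fintype ι] (r : ι → ℝ) :
    HasSum (fun K : ι → ℕ => (∏ i, schmidtCoeff (r i) (K i)) ^ 2) 1 := by
  simpa only [Finset.prod_pow, Finset.prod_const_one] using
    hasSum_pi_prod fun i => hasSum_schmidtCoeff_sq (r i)

theorem orthonormal_numState_extend {ι κ : Type} [Fintype κ] {e : ι → κ}
    (he : Function.Injective e) :
    Orthonormal ℂ fun K : ι → ℕ => numState (Function.extend e K 0) :=
  orthonormal_numState.comp _ fun K L h => funext fun i => by
    simpa only [he.extend_apply] using congrFun h (e i)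

variable {ι κ : Type} [Fintype ι] [Fintype κ] {e : ι → κ}

@[to_additive]
theorem prod_eq_prod_apply_mul_prod_compl [DecidableEq κ] {M : Type*} [CommMonoid M]
    (he : Function.Injective e) (g : κ → M) :
    ∏ j, g j = (∏ i, g (e i)) * ∏ j ∈ (Finset.univ.image e)ᶜ, g j := by
  rw [← Finset.prod_mul_prod_compl (Finset.univ.image e), Finset.prod_image he.injOn]

theorem inner_tensor_numState {ψ : ModeSpace (ι ⊕ κ)} {F : (ι ⊕ κ → ℝ) → ℝ}
    (hψ : ψ =ᵐ[volume] fun z => (F z : ℂ)) (K : ι → ℕ) (L : κ → ℕ) :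
    inner ℂ (tensor (numState K) (numState L)) ψ =
      ((∫ y, numFun L y * ∫ x, numFun K x * F (Sum.elim x y) : ℝ) : ℂ) := by
  set f : (ι ⊕ κ → ℝ) → ℝ := fun z =>
    numFun L (z ∘ Sum.inr) * (numFun K (z ∘ Sum.inl) * F z)
  have hae : (fun z => inner ℂ (tensor (numState K) (numState L) z) (ψ z)) =ᵐ[volume]
      fun z => (f z : ℂ) := by
    filter_upwards [coeFn_tensor (numState K) (numState L), hψ, quasi_inl.ae (coeFn_numState K),
      quasi_inr.ae (coeFn_numState L)] with z htensor hF hK hL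
    rw [htensor, hF, tensorFun, hK, hL, RCLike.inner_apply, ← Complex.ofReal_mul,
      Complex.conj_ofReal, ← Complex.ofReal_mul]
    congr 1
    ring
  have hf : Integrable f := (integrable_congr hae).1 (L2.integrable_inner _ _) |>.re
  have hf' : Integrable (fun w : (ι → ℝ) × (κ → ℝ) => f (Sum.elim w.1 w.2)) :=
    (volume_measurePreserving_sumPiEquivProdPi_symm (fun _ : ι ⊕ κ => ℝ)).integrable_comp_emb
      (MeasurableEquiv.measurableEmbedding _) |>.2 hf
  rw [L2.inner_def, integral_congr_ae hae, integral_complex_ofReal, integral_sum_pi,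
    Measure.volume_eq_prod, integral_prod_symm _ hf']
  simp only [f, Sum.elim_comp_inl, Sum.elim_comp_inr, integral_const_mul]

theorem numFun_extend [DecidableEq κ] (he : Function.Injective e) (K : ι → ℕ) (y : κ → ℝ) :
    numFun (Function.extend e K 0) y = (∏ i, hermiteFun (K i) (y (e i))) *
      ∏ j ∈ (Finset.univ.image e)ᶜ, hermiteFun 0 (y j) := by
  rw [numFun, prod_eq_prod_apply_mul_prod_compl he]
  congr 1
  · simp only [he.extend_apply]
  · refine Finset.prod_congr rfl fun j hj => ?_
    rw [Function.extend_apply' _ _ _ (by simpa using hj), Pi.zero_apply]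

variable [DecidableEq ι] [DecidableEq κ]

theorem numFun_zero_squeezeMatrix_mulVec (he : Function.Injective e) (r : ι → ℝ) (x : ι → ℝ)
    (y : κ → ℝ) :
    numFun 0 (squeezeMatrix e r *ᵥ Sum.elim x y) = (∏ i, squeezedFun (r i) (x i) (y (e i))) *
      ∏ j ∈ (Finset.univ.image e)ᶜ, hermiteFun 0 (y j) := by
  rw [numFun, Fintype.prod_sum_type, prod_eq_prod_apply_mul_prod_compl he, ← mul_assoc,
    ← Finset.prod_mul_distrib]
  congr 1
  · refine Finset.prod_congr rfl fun i _ => ?_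
    rw [squeezeMatrix_mulVec_inl, squeezeMatrix_mulVec_inr_apply he]
    rfl
  · refine Finset.prod_congr rfl fun j hj => ?_
    rw [squeezeMatrix_mulVec_inr_of_notMem _ _ (by simpa using hj)]
    rfl

theorem integral_numFun_mul_squeezed (he : Function.Injective e) (r : ι → ℝ) (K : ι → ℕ)
    (y : κ → ℝ) :
    ∫ x, numFun K x * numFun 0 (squeezeMatrix e r *ᵥ Sum.elim x y) =
      (∏ i, schmidtCoeff (r i) (K i)) * numFun (Function.extend e K 0) y := by
  simp_rw [numFun_zero_squeezeMatrix_mulVec he, ← mul_assoc, numFun, ← Finset.prod_mul_distrib]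
  rw [integral_mul_const, integral_fintype_prod_volume_eq_prod
    (fun i x => hermiteFun (K i) x * squeezedFun (r i) x (y (e i)))]
  simp_rw [integral_hermiteFun_mul_squeezedFun]
  rw [← numFun, numFun_extend he, Finset.prod_mul_distrib, mul_assoc]
  rfl

theorem inner_tensor_squeezedState (he : Function.Injective e) (r : ι → ℝ) (K : ι → ℕ) :
    inner ℂ (tensor (numState K) (numState (Function.extend e K 0))) (squeezedState he r) =
      ((∏ i, schmidtCoeff (r i) (K i) : ℝ) : ℂ) := by
  rw [inner_tensor_numState (coeFn_squeezedState he r)]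
  simp_rw [integral_numFun_mul_squeezed he, mul_left_comm (numFun _ _)]
  rw [integral_const_mul, integral_numFun_mul, if_pos rfl, mul_one]

theorem hasSum_schmidt (he : Function.Injective e) (r : ι → ℝ) :
    HasSum (fun K : ι → ℕ => ((∏ i, schmidtCoeff (r i) (K i) : ℝ) : ℂ) •
      tensor (numState K) (numState (Function.extend e K 0))) (squeezedState he r) := by
  have hon := isTensorIsometry_tensor.orthonormal orthonormal_numState
    (orthonormal_numState_extend he)
  have hbessel := hasSum_prod_schmidtCoeff_sq r
  simp_rw [← inner_tensor_squeezedState he r]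
  refine hasSum_inner_smul hon ?_
  simp_rw [inner_tensor_squeezedState he r, Complex.norm_real, Real.norm_eq_abs, sq_abs,
    norm_squeezedState, one_pow]
  exact hbessel

end SchmidtDecomposition

section MutualInformation

variable {ι κ : Type} [Fintype ι] [Fintype κ]

theorem mutualInformation_eq_of_hasSum {α : Type*} {ψ : ModeSpace (ι ⊕ κ)} {s : α → ℝ}
    {f : α → ModeSpace ι} {g : α → ModeSpace κ} (hf : Orthonormal ℂ f) (hg : Orthonormal ℂ g)
    (hψ : HasSum (fun n => (s n : ℂ) • tensor (f n) (g n)) ψ) (hψ₁ : ‖ψ‖ = 1)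
    (hs : HasSum (fun n => s n ^ 2) 1) {h : ℝ}
    (hh : HasSum (fun n => Real.negMulLog (s n ^ 2)) h) : mutualInformation ψ = 2 * h := by
  have hnonneg : ∀ n, 0 ≤ Real.negMulLog (s n ^ 2) := fun n =>
    Real.negMulLog_nonneg (sq_nonneg _) (le_hasSum hs n fun _ _ => sq_nonneg _)
  have hright : vonNeumannEntropy (partialTraceRight (pureState ψ)) = ENNReal.ofReal h := by
    rw [partialTraceRight, (isTensorIsometry_tensor.isDiagonalOn_partialTrace
      (onb (ModeSpace κ)) hg hψ).vonNeumannEntropy_eq hf hs.summable, ← hh.tsum_eq,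
      ENNReal.ofReal_tsum_of_nonneg hnonneg hh.summable]
  have hleft : vonNeumannEntropy (partialTraceLeft (pureState ψ)) = ENNReal.ofReal h := by
    have hdiag := isTensorIsometry_tensor.flip.isDiagonalOn_partialTrace
      (onb (ModeSpace ι)) hf hψ
    rw [ContinuousLinearMap.flip_flip] at hdiag
    rw [partialTraceLeft, hdiag.vonNeumannEntropy_eq hg hs.summable, ← hh.tsum_eq,
      ENNReal.ofReal_tsum_of_nonneg hnonneg hh.summable]
  rw [mutualInformation, hright, hleft, vonNeumannEntropy_pureState hψ₁,
    ENNReal.toReal_ofReal (hh.nonneg hnonneg), ENNReal.toReal_zero]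
  ring

theorem mutualInformation_squeezedState [DecidableEq ι] [DecidableEq κ] {e : ι → κ}
    (he : Function.Injective e) (r : ι → ℝ) :
    mutualInformation (squeezedState he r) = 2 * ∑ i, thermalEntropy (Real.sinh (r i) ^ 2) := by
  refine mutualInformation_eq_of_hasSum orthonormal_numState (orthonormal_numState_extend he)
    (hasSum_schmidt he r) (norm_squeezedState he r) (hasSum_prod_schmidtCoeff_sq r) ?_
  simpa only [Finset.prod_pow] using hasSum_negMulLog_prod
    (fun i => hasSum_schmidtCoeff_sq (r i)) fun i => hasSum_negMulLog_schmidtCoeff_sq (r i)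

end MutualInformation

section Quadrature

variable {ι : Type} [Fintype ι] [DecidableEq ι] {ψ : ModeSpace ι}

theorem quadratureSq_le (hψ : ‖ψ‖ = 1) {k : ι ⊕ ι} {v : ℝ} (hv : 0 ≤ v)
    (h : ∀ t : ℝ, Real.exp (-(t ^ 2 * v) / 4) ≤ (inner ℂ ψ (weyl (Pi.single k t) ψ)).re) :
    quadratureSq k ψ ≤ ENNReal.ofReal (v / 2) := by
  refine iSup_le fun t => ENNReal.ofReal_le_ofReal ?_
  rcases eq_or_ne t 0 with rfl | ht
  · rw [zero_pow two_ne_zero, div_zero]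
    positivity
  · rw [div_le_iff₀ (by positivity), norm_weyl_sub_sq _ hψ]
    linarith [h t, Real.add_one_le_exp (-(t ^ 2 * v) / 4)]

theorem le_quadratureSq (hψ : ‖ψ‖ = 1) {k : ι ⊕ ι} {v : ℝ} (hv : 0 ≤ v)
    (h : ∀ t : ℝ, (inner ℂ ψ (weyl (Pi.single k t) ψ)).re ≤ Real.exp (-(t ^ 2 * v) / 4)) :
    ENNReal.ofReal (v / 2) ≤ quadratureSq k ψ := by
  have hquotient : ∀ t : ℝ, t ≠ 0 →
      v / 2 / (1 + t ^ 2 * v / 4) ≤ ‖weyl (Pi.single k t) ψ - ψ‖ ^ 2 / t ^ 2 := by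
    intro t ht
    have hexp : Real.exp (-(t ^ 2 * v) / 4) ≤ (1 + t ^ 2 * v / 4)⁻¹ := by
      rw [neg_div, Real.exp_neg]
      exact inv_anti₀ (by positivity) (by linarith [Real.add_one_le_exp (t ^ 2 * v / 4)])
    have hcancel : v / 2 / (1 + t ^ 2 * v / 4) * t ^ 2 = 2 - 2 * (1 + t ^ 2 * v / 4)⁻¹ := by
      field_simp
      ring
    rw [norm_weyl_sub_sq _ hψ, le_div_iff₀ (by positivity), hcancel]
    linarith [h t]
  have hlim : Filter.Tendsto (fun t : ℝ => ENNReal.ofReal (v / 2 / (1 + t ^ 2 * v / 4)))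
      (nhdsWithin 0 {0}ᶜ) (nhds (ENNReal.ofReal (v / 2))) := by
    have hcont : ContinuousAt (fun t : ℝ => v / 2 / (1 + t ^ 2 * v / 4)) 0 :=
      ContinuousAt.div (by fun_prop) (by fun_prop) (by simp)
    refine ENNReal.tendsto_ofReal (Filter.Tendsto.mono_left ?_ nhdsWithin_le_nhds)
    simpa [ContinuousAt] using hcont
  refine le_of_tendsto hlim ?_
  filter_upwards [self_mem_nhdsWithin] with t ht
  exact le_iSup_of_le t (ENNReal.ofReal_le_ofReal (hquotient t ht))

theorem sum_ofReal_half_div_two {α : Type*} [Fintype α] {v : α → ℝ} (hv : ∀ k, 0 ≤ v k) :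
    (∑ k, ENNReal.ofReal (v k / 2)) / 2 = ENNReal.ofReal ((∑ k, v k) / 4) := by
  rw [← ENNReal.ofReal_sum_of_nonneg fun k _ => div_nonneg (hv k) zero_le_two, ← Finset.sum_div,
    ← ENNReal.ofReal_ofNat 2, ← ENNReal.ofReal_div_of_pos two_pos, div_div]
  norm_num

theorem energy_le (hψ : ‖ψ‖ = 1) {v : ι ⊕ ι → ℝ} (hv : ∀ k, 0 ≤ v k)
    (h : ∀ k t, Real.exp (-(t ^ 2 * v k) / 4) ≤ (inner ℂ ψ (weyl (Pi.single k t) ψ)).re) :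
    energy ψ ≤ ENNReal.ofReal ((∑ k, v k) / 4) := by
  rw [← sum_ofReal_half_div_two hv]
  exact ENNReal.div_le_div_right
    (Finset.sum_le_sum fun k _ => quadratureSq_le hψ (hv k) (h k)) 2

theorem le_energy (hψ : ‖ψ‖ = 1) {v : ι ⊕ ι → ℝ} (hv : ∀ k, 0 ≤ v k)
    (h : ∀ k t, (inner ℂ ψ (weyl (Pi.single k t) ψ)).re ≤ Real.exp (-(t ^ 2 * v k) / 4)) :
    ENNReal.ofReal ((∑ k, v k) / 4) ≤ energy ψ := by
  rw [← sum_ofReal_half_div_two hv]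
  exact ENNReal.div_le_div_right
    (Finset.sum_le_sum fun k _ => le_quadratureSq hψ (hv k) (h k)) 2

end Quadrature

section Symplectic

variable {ι : Type*} [Fintype ι] {S : Matrix (ι ⊕ ι) (ι ⊕ ι) ℝ} {D : ι → ℝ}

/-- The diagonal of the covariance matrix `S diag(D, D) Sᵀ`. -/
def quadVariance (S : Matrix (ι ⊕ ι) (ι ⊕ ι) ℝ) (D : ι → ℝ) (k : ι ⊕ ι) : ℝ :=
  ∑ i, D i * (S k (Sum.inl i) ^ 2 + S k (Sum.inr i) ^ 2)

theorem quadVariance_nonneg (S : Matrix (ι ⊕ ι) (ι ⊕ ι) ℝ) (hD : ∀ i, 0 ≤ D i) (k : ι ⊕ ι) :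
    0 ≤ quadVariance S D k :=
  Finset.sum_nonneg fun i _ => mul_nonneg (hD i) (by positivity)

variable [DecidableEq ι]

theorem sum_mul_sq_transpose_mulVec_single (S : Matrix (ι ⊕ ι) (ι ⊕ ι) ℝ) (D : ι → ℝ)
    (k : ι ⊕ ι) (t : ℝ) :
    ∑ i, D i * ((Sᵀ *ᵥ Pi.single k t) (Sum.inl i) ^ 2 +
      (Sᵀ *ᵥ Pi.single k t) (Sum.inr i) ^ 2) = t ^ 2 * quadVariance S D k := by
  rw [quadVariance, Finset.mul_sum]
  refine Finset.sum_congr rfl fun i _ => ?_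
  simp only [Matrix.mulVec_single, Pi.smul_apply, Matrix.col_apply, Matrix.transpose_apply,
    MulOpposite.smul_eq_mul_unop, MulOpposite.unop_op]
  ring

theorem sum_symplectic_form_col (hS : S ∈ Matrix.symplecticGroup ι ℝ) (i : ι) :
    ∑ l, (S (Sum.inl l) (Sum.inl i) * S (Sum.inr l) (Sum.inr i) -
      S (Sum.inr l) (Sum.inl i) * S (Sum.inl l) (Sum.inr i)) = 1 := by
  have h := congrFun (congrFun (SymplecticGroup.mem_iff'.1 hS) (Sum.inl i)) (Sum.inr i)
  rw [Matrix.mul_apply] at h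
  simp only [Matrix.mul_apply, Matrix.J, Fintype.sum_sum_type, Matrix.transpose_apply,
    Matrix.fromBlocks_apply₁₁, Matrix.fromBlocks_apply₁₂, Matrix.fromBlocks_apply₂₁,
    Matrix.fromBlocks_apply₂₂, Matrix.zero_apply, Matrix.neg_apply, Matrix.one_apply, mul_zero,
    Finset.sum_const_zero, zero_add, add_zero, mul_ite, mul_neg, mul_one, Finset.sum_ite_eq',
    Finset.mem_univ, if_true, Finset.sum_neg_distrib, neg_mul] at h
  rw [Finset.sum_sub_distrib]
  linarith

theorem two_le_sum_sq_col_of_symplectic (hS : S ∈ Matrix.symplecticGroup ι ℝ) (i : ι) :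
    2 ≤ ∑ k, (S k (Sum.inl i) ^ 2 + S k (Sum.inr i) ^ 2) := by
  rw [← mul_one 2, ← sum_symplectic_form_col hS i, Finset.mul_sum, Fintype.sum_sum_type,
    ← Finset.sum_add_distrib]
  refine Finset.sum_le_sum fun l _ => ?_
  nlinarith [sq_nonneg (S (Sum.inl l) (Sum.inl i) - S (Sum.inr l) (Sum.inr i)),
    sq_nonneg (S (Sum.inr l) (Sum.inl i) + S (Sum.inl l) (Sum.inr i))]

theorem two_mul_sum_le_sum_quadVariance (hS : S ∈ Matrix.symplecticGroup ι ℝ)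
    (hD : ∀ i, 0 ≤ D i) : 2 * ∑ i, D i ≤ ∑ k, quadVariance S D k := by
  simp only [quadVariance]
  rw [Finset.sum_comm, Finset.mul_sum]
  refine Finset.sum_le_sum fun i _ => ?_
  rw [← Finset.mul_sum, mul_comm]
  exact mul_le_mul_of_nonneg_left (two_le_sum_sq_col_of_symplectic hS i) (hD i)

end Symplectic

section Marginals

variable {ι κ : Type}

theorem forall_quad {p : (ι ⊕ κ) ⊕ (ι ⊕ κ) → Prop} :
    (∀ k, p k) ↔ (∀ k, p (quadInl k)) ∧ ∀ k, p (quadInr k) := by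
  simp only [Sum.forall, quadInl, quadInr, Sum.map_inl, Sum.map_inr]
  tauto

theorem joinPhase_quadInl (a : ι ⊕ ι → ℝ) (b : κ ⊕ κ → ℝ) (k : ι ⊕ ι) :
    joinPhase a b (quadInl k) = a k :=
  congrFun (joinPhase_comp_quadInl a b) k

theorem joinPhase_quadInr (a : ι ⊕ ι → ℝ) (b : κ ⊕ κ → ℝ) (k : κ ⊕ κ) :
    joinPhase a b (quadInr k) = b k :=
  congrFun (joinPhase_comp_quadInr a b) k

theorem single_quadInl [DecidableEq ι] [DecidableEq κ] (k : ι ⊕ ι) (t : ℝ) :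
    (Pi.single (quadInl k) t : (ι ⊕ κ) ⊕ (ι ⊕ κ) → ℝ) = joinPhase (Pi.single k t) 0 := by
  ext l
  rcases k with k | k <;> rcases l with (l | l) | (l | l) <;>
    simp [quadInl, joinPhase, Pi.single_apply]

theorem single_quadInr [DecidableEq ι] [DecidableEq κ] (k : κ ⊕ κ) (t : ℝ) :
    (Pi.single (quadInr k) t : (ι ⊕ κ) ⊕ (ι ⊕ κ) → ℝ) = joinPhase 0 (Pi.single k t) := by
  ext l
  rcases k with k | k <;> rcases l with (l | l) | (l | l) <;>
    simp [quadInr, joinPhase, Pi.single_apply]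

variable [Fintype ι] [Fintype κ]

theorem sum_quad {M : Type*} [AddCommMonoid M] (f : (ι ⊕ κ) ⊕ (ι ⊕ κ) → M) :
    ∑ k, f k = ∑ k, f (quadInl k) + ∑ k, f (quadInr k) := by
  simp only [Fintype.sum_sum_type, quadInl, quadInr, Sum.map_inl, Sum.map_inr]
  exact add_add_add_comm _ _ _ _

/-- The covariance matrices of the two reduced states of `ψ` are `diag(D₁, D₁)` and
`diag(D₂, D₂)`, that is, both reduced states are products of thermal states of single modes. -/
structure HasThermalMarginals (ψ : ModeSpace (ι ⊕ κ)) (D₁ : ι → ℝ) (D₂ : κ → ℝ) : Prop where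
  left : ∀ a : ι ⊕ ι → ℝ, inner ℂ ψ (weyl (joinPhase a 0) ψ) =
    Complex.exp ((-(∑ i, D₁ i * (a (Sum.inl i) ^ 2 + a (Sum.inr i) ^ 2)) / 4 : ℝ) : ℂ)
  right : ∀ b : κ ⊕ κ → ℝ, inner ℂ ψ (weyl (joinPhase 0 b) ψ) =
    Complex.exp ((-(∑ j, D₂ j * (b (Sum.inl j) ^ 2 + b (Sum.inr j) ^ 2)) / 4 : ℝ) : ℂ)

variable [DecidableEq ι] [DecidableEq κ] {ψ : ModeSpace (ι ⊕ κ)} {D₁ : ι → ℝ} {D₂ : κ → ℝ}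

theorem IsLocalGaussianUnitary.exists_norm_inner_weyl
    {U : ModeSpace (ι ⊕ κ) ≃ₗᵢ[ℂ] ModeSpace (ι ⊕ κ)} (hU : IsLocalGaussianUnitary U)
    (hψ : ψ ∈ productSpan ι κ) :
    ∃ S₁ ∈ Matrix.symplecticGroup ι ℝ, ∃ S₂ ∈ Matrix.symplecticGroup κ ℝ, ∀ c,
      ‖(inner ℂ (U ψ) (weyl c (U ψ)) : ℂ)‖ =
        ‖(inner ℂ ψ (weyl (joinPhase (S₁ᵀ *ᵥ (c ∘ quadInl)) (S₂ᵀ *ᵥ (c ∘ quadInr))) ψ) : ℂ)‖ := by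
  obtain ⟨S₁, hS₁, S₂, hS₂, d, hweyl⟩ := hU.exists_weyl
  refine ⟨S₁, hS₁, S₂, hS₂, fun c => ?_⟩
  rw [hweyl c ψ hψ, inner_smul_right, LinearIsometryEquiv.inner_map_map, norm_mul,
    mul_comm Complex.I, Complex.norm_exp_ofReal_mul_I, one_mul]

theorem HasThermalMarginals.le_energy_of_local (h : HasThermalMarginals ψ D₁ D₂)
    (hψ : ‖ψ‖ = 1) (hmem : ψ ∈ productSpan ι κ) (hD₁ : ∀ i, 0 ≤ D₁ i) (hD₂ : ∀ j, 0 ≤ D₂ j)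
    {U : ModeSpace (ι ⊕ κ) ≃ₗᵢ[ℂ] ModeSpace (ι ⊕ κ)} (hU : IsLocalGaussianUnitary U) :
    ENNReal.ofReal ((∑ i, D₁ i + ∑ j, D₂ j) / 2) ≤ energy (U ψ) := by
  obtain ⟨S₁, hS₁, S₂, hS₂, hchar⟩ := hU.exists_norm_inner_weyl hmem
  have hv : ∀ k, 0 ≤ joinPhase (quadVariance S₁ D₁) (quadVariance S₂ D₂) k := by
    refine forall_quad.2 ⟨fun k => ?_, fun k => ?_⟩
    · exact joinPhase_quadInl (κ := κ) _ _ k ▸ quadVariance_nonneg S₁ hD₁ k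
    · exact joinPhase_quadInr (ι := ι) _ _ k ▸ quadVariance_nonneg S₂ hD₂ k
  have hsum : (∑ i, D₁ i + ∑ j, D₂ j) / 2 ≤
      (∑ k, joinPhase (quadVariance S₁ D₁) (quadVariance S₂ D₂) k) / 4 := by
    simp only [sum_quad, joinPhase_quadInl, joinPhase_quadInr]
    linarith [two_mul_sum_le_sum_quadVariance hS₁ hD₁, two_mul_sum_le_sum_quadVariance hS₂ hD₂]
  refine (ENNReal.ofReal_le_ofReal hsum).trans (le_energy (by rw [U.norm_map, hψ]) hv ?_)
  refine forall_quad.2 ⟨fun k t => ?_, fun k t => ?_⟩ <;>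
    refine (Complex.re_le_norm _).trans_eq ?_
  · rw [hchar, single_quadInl, joinPhase_comp_quadInl, joinPhase_comp_quadInr, Matrix.mulVec_zero,
      h.left, sum_mul_sq_transpose_mulVec_single, joinPhase_quadInl, Complex.norm_exp_ofReal]
  · rw [hchar, single_quadInr, joinPhase_comp_quadInl, joinPhase_comp_quadInr, Matrix.mulVec_zero,
      h.right, sum_mul_sq_transpose_mulVec_single, joinPhase_quadInr, Complex.norm_exp_ofReal]

theorem sum_mul_sq_single (D : ι → ℝ) (k : ι ⊕ ι) (t : ℝ) :
    ∑ i, D i * ((Pi.single k t : ι ⊕ ι → ℝ) (Sum.inl i) ^ 2 +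
      (Pi.single k t : ι ⊕ ι → ℝ) (Sum.inr i) ^ 2) = t ^ 2 * Sum.elim D D k := by
  rcases k with k | k <;> simp [Pi.single_apply, mul_comm]

theorem HasThermalMarginals.energy_le (h : HasThermalMarginals ψ D₁ D₂)
    (hψ : ‖ψ‖ = 1) (hD₁ : ∀ i, 0 ≤ D₁ i) (hD₂ : ∀ j, 0 ≤ D₂ j) :
    energy ψ ≤ ENNReal.ofReal ((∑ i, D₁ i + ∑ j, D₂ j) / 2) := by
  have hv : ∀ k, 0 ≤ joinPhase (Sum.elim D₁ D₁) (Sum.elim D₂ D₂) k := by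
    simp only [joinPhase, Sum.forall]
    exact ⟨⟨hD₁, hD₂⟩, hD₁, hD₂⟩
  have hsum : (∑ i, D₁ i + ∑ j, D₂ j) / 2 =
      (∑ k, joinPhase (Sum.elim D₁ D₁) (Sum.elim D₂ D₂) k) / 4 := by
    simp only [joinPhase, Fintype.sum_sum_type, Sum.elim_inl, Sum.elim_inr, Function.comp_apply]
    ring
  rw [hsum]
  refine GaussianModes.energy_le hψ hv (forall_quad.2 ⟨fun k t => ?_, fun k t => ?_⟩)
  · rw [single_quadInl, h.left, sum_mul_sq_single, joinPhase_quadInl, Complex.exp_ofReal_re]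
  · rw [single_quadInr, h.right, sum_mul_sq_single, joinPhase_quadInr, Complex.exp_ofReal_re]

theorem HasThermalMarginals.iInf_energy_local (h : HasThermalMarginals ψ D₁ D₂)
    (hψ : ‖ψ‖ = 1) (hmem : ψ ∈ productSpan ι κ) (hD₁ : ∀ i, 0 ≤ D₁ i) (hD₂ : ∀ j, 0 ≤ D₂ j) :
    ⨅ U : {U : ModeSpace (ι ⊕ κ) ≃ₗᵢ[ℂ] ModeSpace (ι ⊕ κ) // IsLocalGaussianUnitary U},
      energy (U.1 ψ) = ENNReal.ofReal ((∑ i, D₁ i + ∑ j, D₂ j) / 2) :=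
  le_antisymm (iInf_le_of_le ⟨.refl ℂ _, .refl⟩ (h.energy_le hψ hD₁ hD₂))
    (le_iInf fun U => h.le_energy_of_local hψ hmem hD₁ hD₂ U.2)

end Marginals

section SqueezedGap

variable {ι κ : Type} [Fintype ι] [Fintype κ] {e : ι → κ}

theorem sum_cosh_add_sum_cosh_extend (he : Function.Injective e) (r : ι → ℝ) :
    (∑ i, Real.cosh (2 * r i) + ∑ j, Real.cosh (2 * Function.extend e r 0 j)) / 2 =
      (Fintype.card ι + Fintype.card κ : ℝ) / 2 + 2 * ∑ i, Real.sinh (r i) ^ 2 := by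
  have hcosh : ∀ x : ℝ, Real.cosh (2 * x) = 1 + 2 * Real.sinh x ^ 2 := fun x => by
    rw [Real.cosh_two_mul, Real.cosh_sq]
    ring
  have hextend : ∑ j, Real.sinh (Function.extend e r 0 j) ^ 2 = ∑ i, Real.sinh (r i) ^ 2 := by
    refine (Fintype.sum_of_injective e he _ _ (fun j hj => ?_) fun i => ?_).symm
    · rw [Function.extend_apply' _ _ _ hj, Pi.zero_apply, Real.sinh_zero, zero_pow two_ne_zero]
    · rw [he.extend_apply]
  simp only [hcosh, Finset.sum_add_distrib, ← Finset.mul_sum, hextend, Finset.sum_const,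
    Finset.card_univ, nsmul_one]
  ring

variable [DecidableEq ι] [DecidableEq κ]

theorem sum_sq_squeezeMatrix_inl (he : Function.Injective e) (r x : ι → ℝ) :
    ∑ k, (squeezeMatrix e r *ᵥ Sum.elim x 0) k ^ 2 = ∑ i, Real.cosh (2 * r i) * x i ^ 2 := by
  have hcompl : ∑ j ∈ (Finset.univ.image e)ᶜ,
      (squeezeMatrix e r *ᵥ Sum.elim x 0) (Sum.inr j) ^ 2 = 0 := by
    refine Finset.sum_eq_zero fun j hj => ?_
    rw [squeezeMatrix_mulVec_inr_of_notMem _ _ (by simpa using hj), Sum.elim_inr, Pi.zero_apply,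
      zero_pow two_ne_zero]
  rw [Fintype.sum_sum_type, sum_eq_sum_apply_add_sum_compl he, hcompl, add_zero,
    ← Finset.sum_add_distrib]
  refine Finset.sum_congr rfl fun i _ => ?_
  rw [squeezeMatrix_mulVec_inl, squeezeMatrix_mulVec_inr_apply he, Real.cosh_two_mul,
    Sum.elim_inl, Sum.elim_inr, Pi.zero_apply]
  ring

theorem sum_sq_squeezeMatrix_inr (he : Function.Injective e) (r : ι → ℝ) (y : κ → ℝ) :
    ∑ k, (squeezeMatrix e r *ᵥ Sum.elim 0 y) k ^ 2 =
      ∑ j, Real.cosh (2 * Function.extend e r 0 j) * y j ^ 2 := by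
  have hcompl : ∑ j ∈ (Finset.univ.image e)ᶜ,
      (squeezeMatrix e r *ᵥ Sum.elim 0 y) (Sum.inr j) ^ 2 =
      ∑ j ∈ (Finset.univ.image e)ᶜ, Real.cosh (2 * Function.extend e r 0 j) * y j ^ 2 := by
    refine Finset.sum_congr rfl fun j hj => ?_
    rw [squeezeMatrix_mulVec_inr_of_notMem _ _ (by simpa using hj),
      Function.extend_apply' _ _ _ (by simpa using hj), Sum.elim_inr, Pi.zero_apply, mul_zero,
      Real.cosh_zero, one_mul]
  rw [Fintype.sum_sum_type, sum_eq_sum_apply_add_sum_compl he, hcompl, ← add_assoc,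
    ← Finset.sum_add_distrib, sum_eq_sum_apply_add_sum_compl he fun j =>
      Real.cosh (2 * Function.extend e r 0 j) * y j ^ 2]
  refine congrArg (· + _) (Finset.sum_congr rfl fun i _ => ?_)
  rw [squeezeMatrix_mulVec_inl, squeezeMatrix_mulVec_inr_apply he, Real.cosh_two_mul,
    he.extend_apply, Sum.elim_inl, Sum.elim_inr, Pi.zero_apply]
  ring

theorem hasThermalMarginals_squeezedState (he : Function.Injective e) (r : ι → ℝ) :
    HasThermalMarginals (squeezedState he r) (fun i => Real.cosh (2 * r i))
      fun j => Real.cosh (2 * Function.extend e r 0 j) where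
  left a := by
    have hq : joinPhase a (0 : κ ⊕ κ → ℝ) ∘ Sum.inl = Sum.elim (a ∘ Sum.inl) 0 := rfl
    have hp : joinPhase a (0 : κ ⊕ κ → ℝ) ∘ Sum.inr = Sum.elim (a ∘ Sum.inr) 0 := rfl
    rw [inner_squeezedState_weyl, hq, hp, sum_sq_squeezeMatrix_inl he, sum_sq_squeezeMatrix_inl he,
      ← Finset.sum_add_distrib]
    simp only [Pi.neg_apply, mul_neg, Real.cosh_neg, Function.comp_apply, mul_add]
  right b := by
    have hq : joinPhase (0 : ι ⊕ ι → ℝ) b ∘ Sum.inl = Sum.elim (0 : ι → ℝ) (b ∘ Sum.inl) := rfl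
    have hp : joinPhase (0 : ι ⊕ ι → ℝ) b ∘ Sum.inr = Sum.elim (0 : ι → ℝ) (b ∘ Sum.inr) := rfl
    rw [inner_squeezedState_weyl, hq, hp, sum_sq_squeezeMatrix_inr he, sum_sq_squeezeMatrix_inr he,
      ← Finset.sum_add_distrib, extend_neg_zero]
    simp only [Pi.neg_apply, mul_neg, Real.cosh_neg, Function.comp_apply, mul_add]

theorem ergotropicGap_squeezedState (he : Function.Injective e) (r : ι → ℝ) :
    ergotropicGap (squeezedState he r) =
      (Fintype.card ι + Fintype.card κ : ℝ) / 2 + 2 * ∑ i, Real.sinh (r i) ^ 2 -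
      (⨅ U : {U : ModeSpace (ι ⊕ κ) ≃ₗᵢ[ℂ] ModeSpace (ι ⊕ κ) // IsGaussianUnitary U},
        energy (U.1 (numState 0))).toReal := by
  have hlocal := (hasThermalMarginals_squeezedState he r).iInf_energy_local
    (norm_squeezedState he r) (mem_productSpan_of_hasSum (hasSum_schmidt he r))
    (fun _ => (Real.cosh_pos _).le) fun _ => (Real.cosh_pos _).le
  have hglobal := iInf_energy_orbit (isGaussianUnitary_pullback (abs_det_squeezeMatrix he r))
    (numState 0)
  rw [sum_cosh_add_sum_cosh_extend he] at hlocal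
  rw [ergotropicGap, globalErgotropy, localErgotropy, hlocal,
    ENNReal.toReal_ofReal (by positivity), ← hglobal, squeezedState]
  ring

end SqueezedGap

section Counterexample

theorem sum_apply_single {ι : Type*} [Fintype ι] [DecidableEq ι] {f : ℝ → ℝ} (hf : f 0 = 0)
    (i : ι) (x : ℝ) : ∑ j, f ((Pi.single i x : ι → ℝ) j) = f x := by
  simp only [Pi.apply_single (fun _ => f) fun _ => hf]
  exact Fintype.sum_pi_single' i (f x)

theorem exists_mutualInformation_eq_ergotropicGap_ne {ι κ : Type} [Fintype ι] [Fintype κ]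
    [DecidableEq ι] [DecidableEq κ] [Nontrivial ι] {e : ι → κ} (he : Function.Injective e) :
    ∃ ψ φ : ModeSpace (ι ⊕ κ), IsPureGaussian ψ ∧ IsPureGaussian φ ∧
      mutualInformation ψ = mutualInformation φ ∧ ergotropicGap ψ ≠ ergotropicGap φ := by
  obtain ⟨i₀⟩ : Nonempty ι := inferInstance
  obtain ⟨b, hb, hentropy⟩ := exists_thermalEntropy_eq_mul (Fintype.one_lt_card (α := ι))
  have hspread : Real.sinh (Real.arsinh 1) ^ 2 = 1 := by rw [Real.sinh_arsinh, one_pow]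
  have hpeak : Real.sinh (Real.arsinh √b) ^ 2 = b := by
    rw [Real.sinh_arsinh, Real.sq_sqrt ((Nat.cast_nonneg _).trans hb.le)]
  have hzero : Real.sinh 0 ^ 2 = 0 := by rw [Real.sinh_zero, zero_pow two_ne_zero]
  refine ⟨squeezedState he fun _ => Real.arsinh 1,
    squeezedState he (Pi.single i₀ (Real.arsinh √b)), isPureGaussian_squeezedState he _,
    isPureGaussian_squeezedState he _, ?_, ?_⟩
  · rw [mutualInformation_squeezedState, mutualInformation_squeezedState,
      sum_apply_single (f := fun x => thermalEntropy (Real.sinh x ^ 2))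
        (by rw [hzero, thermalEntropy_zero]), hspread, hpeak, hentropy, Finset.sum_const,
      Finset.card_univ, nsmul_eq_mul]
  · rw [ergotropicGap_squeezedState, ergotropicGap_squeezedState,
      sum_apply_single (f := fun x => Real.sinh x ^ 2) hzero, hspread, hpeak, Finset.sum_const,
      Finset.card_univ, nsmul_one]
    linarith

end Counterexample

end GaussianModes

end

theorem mainTheorem10 (m₁ m₂ : ℕ) (hm₁ : 2 ≤ m₁) (hm₁₂ : m₁ ≤ m₂) :
    ¬ ∃ F : ℝ → ℝ, ∀ ψ : GaussianModes.ModeSpace (Fin m₁ ⊕ Fin m₂),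
      GaussianModes.IsPureGaussian ψ →
        GaussianModes.ergotropicGap ψ = F (GaussianModes.mutualInformation ψ) := by
  rintro ⟨F, hF⟩
  have : Nontrivial (Fin m₁) := Fin.nontrivial_iff_two_le.2 hm₁
  obtain ⟨ψ, φ, hψ, hφ, hinformation, hgap⟩ :=
    GaussianModes.exists_mutualInformation_eq_ergotropicGap_ne (Fin.castLE_injective hm₁₂)
  exact hgap (by rw [hF ψ hψ, hF φ hφ, hinformation])
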